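/- Let $N\ge 0$, $-1=y_0<y_1<\dots<y_N<y_{N+1}=1$, $g_1,\dots,g_N>0$ and $l_k=y_{k+1}-y_k$ $(0\le k\le N)$. Consider the discrete dual cubic string $$\psi_1'=g\,\psi_2,\qquad \psi_2'=g\,\psi_3,\qquad \psi_3'=-z\,\psi_1\quad\text{on }(-1,1),\qquad g=\sum_{k=1}^N g_k\,\delta(y-y_k),$$ that is: $\psi_3$ is continuous, between the points $y_k$ the functions $\psi_1,\psi_2$ are constant and $\psi_3'=-z\psi_1$, and $\psi_1(y_k+)-\psi_1(y_k-)=g_k\,\tfrac12\big(\psi_2(y_k-)+\psi_2(y_k+)\big)$, $\psi_2(y_k+)-\psi_2(y_k-)=g_k\psi_3(y_k)$ for $1\le k\le N$. Its eigenvalues are the $z\in\mathbb C$ for which there is a nontrivial solution with $\psi_2(-1)=\psi_3(-1)=0$, $\psi_3(1)=0$, and its Weyl function is $W(z)=-\psi_2(1;z)/\psi_3(1;z)$, where $\psi(\cdot;z)$ is the solution with $\psi(-1;z)=(1,0,0)$. Let $0<\zeta_1<\dots<\zeta_N$ and $b_1,\dots,b_N>0$ be the spectral data of the string, i.e. the eigenvalues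 are exactly $0,\zeta_1,\dots,\zeta_N$, and $W(z)=\sum_{j=1}^N\frac{b_j}{z-\zeta_j}$ whenever $z$ is not an eigenvalue. Put $\mu=\sum_{j=1}^N b_j\delta_{\zeta_j}$ and, for integers $i,j$, $$\beta_j=\int x^j\,d\mu(x),\qquad I_{i,j}=\iint\frac{x^iy^j}{x+y}\,d\mu(x)d\mu(y),\qquad J_{i,j}=\iint\frac{y-x}{x+y}\,x^iy^j\,d\mu(x)d\mu(y).$$ Let $F_k^{(i,j)}=\det\big(I_{i+a,j+b}\big)_{a,b=0}^{k-1}$ for $k\ge1$, $F_0^{(i,j)}=1$, and $F_k^{(i,j)}=0$ for $k<0$. Let $\tau_k^{(l)}=\mathrm{Pf}\big(J_{l+i,l+j}\big)_{i,j=0}^{k-1}$ for even $k\ge2$, $$\tau_k^{(l)}=\mathrm{Pf}\begin{pmatrix}0&(\beta_{l+j})_j\\ -(\beta_{l+i})_i&(J_{l+i,l+j})_{i,j}\end{pmatrix}_{i,j=0}^{k-1}\quad\text{for odd }k\ge1,$$ $\tau_0^{(l)}=1$, and $\tau_k^{(l)}=0$ for $k<0$. Then the string $\{y_k,g_k\}_{k=1}^N$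 is uniquely recovered from $\{\zeta_k,b_k\}_{k=1}^N$: it is the only string with $N$ positive masses and with these spectral data, and $$g_{N-k+1}=\frac{\tau_{k-1}^{(1)}}{\tau_k^{(0)}}-\frac{\tau_{k+1}^{(-1)}}{\tau_k^{(0)}}-\frac{\tau_{k-2}^{(1)}}{\tau_{k-1}^{(0)}}+\frac{\tau_k^{(-1)}}{\tau_{k-1}^{(0)}}=\frac{2^k\big(F_k^{(0,0)}+\frac12F_{k-1}^{(1,1)}\big)}{\tau_k^{(0)}\tau_{k-1}^{(0)}}\qquad(1\le k\le N),$$ $$l_{N-k}=\frac{\big(\tau_k^{(0)}\big)^4}{2^{2k}\big(F_{k+1}^{(0,0)}+\frac12F_k^{(1,1)}\big)\big(F_k^{(0,0)}+\frac12F_{k-1}^{(1,1)}\big)}\qquad(0\le k\le N),$$ $$y_{N-k+1}=\frac{F_k^{(0,0)}-\frac12F_{k-1}^{(1,1)}}{F_k^{(0,0)}+\frac12F_{k-1}^{(1,1)}}\qquad(1\le k\le N).$$ -/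

import Mathlib

open MeasureTheory Filter Topology

noncomputable section

namespace DualCubic

/-! ### Moments, bimoments, determinants and Pfaffians of a measure on the half-line -/

/-- The moment `β_j = ∫ x^j dμ(x)`, for an integer `j`. -/
def moment (μ : Measure ℝ) (j : ℤ) : ℝ :=
  ∫ x, x ^ j ∂μ

/-- The Cauchy bimoment `I_{i,j} = ∬ x^i y^j / (x + y) dμ(x) dμ(y)`. -/
def bimoment (μ : Measure ℝ) (i j : ℤ) : ℝ :=
  ∫ x, ∫ y, x ^ i * y ^ j / (x + y) ∂μ ∂μ

/-- The skew bimoment `J_{i,j} = ∬ (y - x) / (x + y) x^i y^j dμ(x) dμ(y)`. -/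
def skewBimoment (μ : Measure ℝ) (i j : ℤ) : ℝ :=
  ∫ x, ∫ y, (y - x) / (x + y) * x ^ i * y ^ j ∂μ ∂μ

/-- The bimoment determinant `F_k^{(i,j)} = det (I_{i+a,j+b})_{0 ≤ a, b < k}`, which is `1` for
`k = 0`, and `0` for `k < 0`. -/
def bimomentDet (μ : Measure ℝ) (k : ℤ) (i j : ℤ) : ℝ :=
  if 0 ≤ k then
    Matrix.det (Matrix.of fun a b : Fin k.toNat => bimoment μ (i + (a : ℕ)) (j + (b : ℕ)))
  else 0

/-- The permutations `σ` of `{0, …, 2m-1}` that list a perfect matching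
`{σ 0, σ 1}, {σ 2, σ 3}, …` in its normal form: `σ (2a) < σ (2a+1)` in each pair, and the pairs
are ordered by their first elements. -/
def IsPairing {m : ℕ} (σ : Equiv.Perm (Fin (2 * m))) : Prop :=
  (∀ a : Fin m, σ ⟨2 * a, by omega⟩ < σ ⟨2 * a + 1, by omega⟩) ∧
    ∀ a b : Fin m, a < b → σ ⟨2 * a, by omega⟩ < σ ⟨2 * b, by omega⟩

open Classical in
/-- The Pfaffian of a skew-symmetric matrix of order `2m`, as a signed sum over the perfect
matchings of the index set. -/
def pfaffian {m : ℕ} (A : Matrix (Fin (2 * m)) (Fin (2 * m)) ℝ) : ℝ :=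
  ∑ σ : Equiv.Perm (Fin (2 * m)) with IsPairing σ,
    ((Equiv.Perm.sign σ : ℤ) : ℝ) *
      ∏ a : Fin m, A (σ ⟨2 * a, by omega⟩) (σ ⟨2 * a + 1, by omega⟩)

/-- The matrix `(J_{l+i,l+j})_{0 ≤ i, j < n}`. -/
def skewMatrix (μ : Measure ℝ) (l : ℤ) (n : ℕ) : Matrix (Fin n) (Fin n) ℝ :=
  Matrix.of fun i j => skewBimoment μ (l + (i : ℕ)) (l + (j : ℕ))

/-- The matrix of order `n` (for `n ≥ 1`) with first row `(0, β_l, β_{l+1}, …, β_{l+n-2})`, first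
column the negative of the first row, and the block `(J_{l+i,l+j})_{0 ≤ i, j < n-1}` in the
other places. -/
def borderedMatrix (μ : Measure ℝ) (l : ℤ) (n : ℕ) : Matrix (Fin n) (Fin n) ℝ :=
  Matrix.of fun i j =>
    if (i : ℕ) = 0 then
      if (j : ℕ) = 0 then 0 else moment μ (l + (j : ℕ) - 1)
    else
      if (j : ℕ) = 0 then -moment μ (l + (i : ℕ) - 1)
      else skewBimoment μ (l + (i : ℕ) - 1) (l + (j : ℕ) - 1)

/-- The Pfaffian `τ_k^{(l)}`: of the matrix `(J_{l+i,l+j})` of order `k` if `k ≥ 0` is even, of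
the bordered matrix of order `k + 1` if `k ≥ 0` is odd, and `0` for `k < 0`. -/
def tau (μ : Measure ℝ) (k : ℤ) (l : ℤ) : ℝ :=
  if k < 0 then 0
  else if Even k then pfaffian (skewMatrix μ l (2 * (k.toNat / 2)))
  else pfaffian (borderedMatrix μ l (2 * (k.toNat / 2 + 1)))

/-- The discrete measure `∑_j b_j δ_{ζ_j}`. -/
def spectralMeasure {N : ℕ} (ζ b : Fin N → ℝ) : Measure ℝ :=
  ∑ j, ENNReal.ofReal (b j) • Measure.dirac (ζ j)

/-! ### The discrete dual cubic string -/

end DualCubic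

/-- A discrete dual cubic string with `N` point masses of sizes `g_k > 0` at the positions
`-1 < y_1 < ⋯ < y_N < 1`. (The index `i : Fin N` stands for `k = i + 1`.) -/
@[ext]
structure DualCubicString (N : ℕ) where
  y : Fin N → ℝ
  g : Fin N → ℝ
  strictMono : StrictMono y
  neg_one_lt : ∀ i, -1 < y i
  lt_one : ∀ i, y i < 1
  g_pos : ∀ i, 0 < g i

namespace DualCubicString

variable {N : ℕ}

/-- The position `y_k` for `0 ≤ k ≤ N + 1`, where `y_0 = -1` and `y_{N+1} = 1`. -/
def pos (s : DualCubicString N) (k : ℕ) : ℝ :=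
  if k = 0 then -1 else if h : k - 1 < N then s.y ⟨k - 1, h⟩ else 1

/-- The mass `g_k` for `1 ≤ k ≤ N`. -/
def mass (s : DualCubicString N) (k : ℕ) : ℝ :=
  if h : 1 ≤ k ∧ k ≤ N then s.g ⟨k - 1, by omega⟩ else 0

/-- The distance `l_k = y_{k+1} - y_k` for `0 ≤ k ≤ N`. -/
def gap (s : DualCubicString N) (k : ℕ) : ℝ :=
  s.pos (k + 1) - s.pos k

/-- `(ψ₁, ψ₂, ψ₃)` solves the system `ψ₁' = g ψ₂`, `ψ₂' = g ψ₃`, `ψ₃' = -z ψ₁` on `[-1, 1]`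
with `g = ∑_k g_k δ(y - y_k)`, where the product `δ(y - y_k) ψ₂` is given by the average of the
one-sided limits of `ψ₂` at `y_k`. -/
structure IsSolution (s : DualCubicString N) (z : ℂ) (ψ₁ ψ₂ ψ₃ : ℝ → ℂ) : Prop where
  deriv_between : ∀ k ≤ N, ∀ x ∈ Set.Ioo (s.pos k) (s.pos (k + 1)),
    HasDerivAt ψ₁ 0 x ∧ HasDerivAt ψ₂ 0 x ∧ HasDerivAt ψ₃ (-z * ψ₁ x) x
  continuousOn : ContinuousOn ψ₃ (Set.Icc (-1) 1)
  left_end : ContinuousWithinAt ψ₁ (Set.Ici (-1)) (-1) ∧ ContinuousWithinAt ψ₂ (Set.Ici (-1)) (-1)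
  right_end : ContinuousWithinAt ψ₁ (Set.Iic 1) 1 ∧ ContinuousWithinAt ψ₂ (Set.Iic 1) 1
  jump : ∀ k, 1 ≤ k → k ≤ N → ∃ L₁ R₁ L₂ R₂ : ℂ,
    Tendsto ψ₁ (𝓝[<] (s.pos k)) (𝓝 L₁) ∧ Tendsto ψ₁ (𝓝[>] (s.pos k)) (𝓝 R₁) ∧
    Tendsto ψ₂ (𝓝[<] (s.pos k)) (𝓝 L₂) ∧ Tendsto ψ₂ (𝓝[>] (s.pos k)) (𝓝 R₂) ∧
    R₁ - L₁ = (s.mass k : ℂ) * ((L₂ + R₂) / 2) ∧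
    R₂ - L₂ = (s.mass k : ℂ) * ψ₃ (s.pos k)

/-- `z` is an eigenvalue of the boundary value problem `ψ₂(-1) = ψ₃(-1) = 0`, `ψ₃(1) = 0`: it has
a solution that does not vanish identically off the point masses (at which the values of
`ψ₁` and `ψ₂` carry no meaning). -/
def IsEigenvalue (s : DualCubicString N) (z : ℂ) : Prop :=
  ∃ ψ₁ ψ₂ ψ₃ : ℝ → ℂ, s.IsSolution z ψ₁ ψ₂ ψ₃ ∧
    ψ₂ (-1) = 0 ∧ ψ₃ (-1) = 0 ∧ ψ₃ 1 = 0 ∧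
    ∃ x ∈ Set.Icc (-1 : ℝ) 1, (∀ i, x ≠ s.y i) ∧ (ψ₁ x ≠ 0 ∨ ψ₂ x ≠ 0 ∨ ψ₃ x ≠ 0)

/-- `w` is the value at `z` of the Weyl function `-ψ₂(1; z) / ψ₃(1; z)`, where `ψ(·; z)` is the
solution with `ψ(-1; z) = (1, 0, 0)`. -/
def IsWeylValue (s : DualCubicString N) (z w : ℂ) : Prop :=
  ∃ ψ₁ ψ₂ ψ₃ : ℝ → ℂ, s.IsSolution z ψ₁ ψ₂ ψ₃ ∧
    ψ₁ (-1) = 1 ∧ ψ₂ (-1) = 0 ∧ ψ₃ (-1) = 0 ∧ ψ₃ 1 ≠ 0 ∧ w = -ψ₂ 1 / ψ₃ 1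

/-- `(ζ_j, b_j)` are the spectral data of the string: the eigenvalues are `0` and the `ζ_j`, and
`b_j` are the residues at the `ζ_j` of the Weyl function, which is the Stieltjes transform
`∑_j b_j / (z - ζ_j)` of the measure `∑_j b_j δ_{ζ_j}`. -/
structure HasSpectralData (s : DualCubicString N) (ζ b : Fin N → ℝ) : Prop where
  spectrum : ∀ z : ℂ, s.IsEigenvalue z ↔ z = 0 ∨ ∃ j, z = (ζ j : ℂ)
  weyl : ∀ z : ℂ, ¬ s.IsEigenvalue z → s.IsWeylValue z (∑ j, (b j : ℂ) / (z - (ζ j : ℂ)))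

end DualCubicString

end

open DualCubic

noncomputable section

namespace DualCubic

/-! ### Pfaffians as alternating maps -/

/-- The bijection `(a, i) ↦ 2 a + i`. -/
def pairIndex (m : ℕ) : Fin m × Fin 2 ≃ Fin (2 * m) :=
  finProdFinEquiv.trans (finCongr (mul_comm m 2))

theorem pairIndex_zero {m : ℕ} (a : Fin m) : pairIndex m (a, 0) = ⟨2 * a, by omega⟩ := by
  ext; simp [pairIndex]

theorem pairIndex_one {m : ℕ} (a : Fin m) : pairIndex m (a, 1) = ⟨2 * a + 1, by omega⟩ := by
  ext; simp [pairIndex]; omega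

/-- The signed product attached to a permutation in the expansion of the Pfaffian. -/
def pairTerm {m : ℕ} (A : Matrix (Fin (2 * m)) (Fin (2 * m)) ℝ)
    (σ : Equiv.Perm (Fin (2 * m))) : ℝ :=
  ((Equiv.Perm.sign σ : ℤ) : ℝ) *
    ∏ a : Fin m, A (σ (pairIndex m (a, 0))) (σ (pairIndex m (a, 1)))

/-- The permutation that permutes the pairs by `x.2` and flips within each pair by `x.1`. -/
def pairPerm {m : ℕ} (x : (Fin m → Equiv.Perm (Fin 2)) × Equiv.Perm (Fin m)) :
    Equiv.Perm (Fin (2 * m)) :=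
  (pairIndex m).permCongr
    (Equiv.prodCongrRight x.1 * Equiv.prodCongrLeft (fun _ => x.2))

theorem pairPerm_apply {m : ℕ} (x : (Fin m → Equiv.Perm (Fin 2)) × Equiv.Perm (Fin m))
    (a : Fin m) (i : Fin 2) :
    pairPerm x (pairIndex m (a, i)) = pairIndex m (x.2 a, x.1 (x.2 a) i) := by
  simp [pairPerm]

theorem sign_pairPerm {m : ℕ} (x : (Fin m → Equiv.Perm (Fin 2)) × Equiv.Perm (Fin m)) :
    Equiv.Perm.sign (pairPerm x) = ∏ c, Equiv.Perm.sign (x.1 c) := by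
  rw [pairPerm, Equiv.Perm.sign_permCongr, Equiv.Perm.sign_mul, Equiv.Perm.sign_prodCongrRight,
    Equiv.Perm.sign_prodCongrLeft]
  simp

theorem perm_fin_two_eq (e : Equiv.Perm (Fin 2)) : e = 1 ∨ e = Equiv.swap 0 1 := by
  revert e; decide

theorem pairTerm_mul_pairPerm {m : ℕ} {A : Matrix (Fin (2 * m)) (Fin (2 * m)) ℝ}
    (hA : ∀ i j, A i j = -A j i) (σ : Equiv.Perm (Fin (2 * m)))
    (x : (Fin m → Equiv.Perm (Fin 2)) × Equiv.Perm (Fin m)) :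
    pairTerm A (σ * pairPerm x) = pairTerm A σ := by
  have key : ∏ a : Fin m, A ((σ * pairPerm x) (pairIndex m (a, 0)))
        ((σ * pairPerm x) (pairIndex m (a, 1))) =
      ((∏ c, Equiv.Perm.sign (x.1 c) : ℤˣ) : ℤ) *
        ∏ a : Fin m, A (σ (pairIndex m (a, 0))) (σ (pairIndex m (a, 1))) := by
    simp only [Equiv.Perm.mul_apply, pairPerm_apply]
    rw [Equiv.prod_comp x.2 (fun c => A (σ (pairIndex m (c, x.1 c 0)))
      (σ (pairIndex m (c, x.1 c 1))))]
    push_cast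
    rw [← Finset.prod_mul_distrib]
    refine Finset.prod_congr rfl fun c _ => ?_
    rcases perm_fin_two_eq (x.1 c) with h | h
    · simp [h]
    · rw [h, Equiv.Perm.sign_swap (by decide)]
      simp only [Equiv.swap_apply_left, Equiv.swap_apply_right]
      rw [hA]; simp
  rw [pairTerm, key, pairTerm, Equiv.Perm.sign_mul, sign_pairPerm, ← mul_assoc]
  congr 1
  set u := ∏ c, Equiv.Perm.sign (x.1 c)
  rcases Int.units_eq_one_or u with h | h <;> simp [h]

theorem isPairing_iff {m : ℕ} (σ : Equiv.Perm (Fin (2 * m))) :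
    IsPairing σ ↔ (∀ a, σ (pairIndex m (a, 0)) < σ (pairIndex m (a, 1))) ∧
      StrictMono fun a => σ (pairIndex m (a, 0)) := by
  simp only [IsPairing, pairIndex_zero, pairIndex_one, StrictMono]

theorem existsUnique_isPairing_mul {m : ℕ} (σ : Equiv.Perm (Fin (2 * m))) :
    ∃! x : (Fin m → Equiv.Perm (Fin 2)) × Equiv.Perm (Fin m), IsPairing (σ * pairPerm x) := by
  have hinj : Function.Injective (fun p => σ (pairIndex m p)) :=
    σ.injective.comp (pairIndex m).injective
  have hε : ∀ c, ∃! e : Equiv.Perm (Fin 2),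
      σ (pairIndex m (c, e 0)) < σ (pairIndex m (c, e 1)) := by
    intro c
    have hne : σ (pairIndex m (c, 0)) ≠ σ (pairIndex m (c, 1)) := fun h => by
      simpa using hinj h
    rcases lt_or_gt_of_ne hne with h | h
    · refine ⟨1, by simpa using h, fun e he => ?_⟩
      rcases perm_fin_two_eq e with rfl | rfl
      · rfl
      · simp only [Equiv.swap_apply_left, Equiv.swap_apply_right] at he
        exact absurd he h.not_gt
    · refine ⟨Equiv.swap 0 1, by simpa using h, fun e he => ?_⟩
      rcases perm_fin_two_eq e with rfl | rfl
      · exact absurd he h.not_gt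
      · rfl
  choose ε hε1 hε2 using hε
  set f : Fin m → Fin (2 * m) := fun c => σ (pairIndex m (c, ε c 0)) with hf
  have hfinj : Function.Injective f := fun c d h => by
    have := hinj h
    simp only [Prod.mk.injEq] at this
    exact this.1
  refine ⟨(ε, Tuple.sort f), ?_, ?_⟩
  · refine (isPairing_iff _).2 ?_
    simp only [Equiv.Perm.mul_apply, pairPerm_apply]
    exact ⟨fun a => hε1 _, (Tuple.monotone_sort f).strictMono_of_injective
      (hfinj.comp (Tuple.sort f).injective)⟩
  · rintro ⟨ε', π⟩ h
    rw [isPairing_iff] at h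
    simp only [Equiv.Perm.mul_apply, pairPerm_apply] at h
    have h1 : ε' = ε := by
      funext c
      have := h.1 (π.symm c)
      rw [Equiv.apply_symm_apply] at this
      exact hε2 c _ this
    subst h1
    have h2 : f ∘ π = f ∘ Tuple.sort f :=
      Tuple.unique_monotone h.2.monotone (Tuple.monotone_sort f)
    simp only [Prod.mk.injEq, true_and]
    ext1 a
    exact hfinj (congrFun h2 a)

/-- The number of permutations of `{0, …, 2m-1}` that preserve a given perfect matching. -/
def pairCount (m : ℕ) : ℝ :=
  Fintype.card ((Fin m → Equiv.Perm (Fin 2)) × Equiv.Perm (Fin m))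

theorem pairCount_ne_zero (m : ℕ) : pairCount m ≠ 0 := by
  unfold pairCount
  exact_mod_cast Fintype.card_ne_zero

theorem sum_pairTerm {m : ℕ} {A : Matrix (Fin (2 * m)) (Fin (2 * m)) ℝ}
    (hA : ∀ i j, A i j = -A j i) :
    ∑ σ, pairTerm A σ = pairCount m * pfaffian A := by
  classical
  have h1 : ∀ σ : Equiv.Perm (Fin (2 * m)), pairTerm A σ =
      ∑ x, if IsPairing (σ * pairPerm x) then pairTerm A (σ * pairPerm x) else 0 := by
    intro σ
    obtain ⟨x, hx, hx'⟩ := existsUnique_isPairing_mul σ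
    rw [Finset.sum_eq_single x]
    · rw [if_pos hx, pairTerm_mul_pairPerm hA]
    · intro y _ hy
      exact if_neg fun h => hy (hx' y h)
    · simp
  have h2 : pfaffian A = ∑ σ, if IsPairing σ then pairTerm A σ else 0 := by
    rw [pfaffian, Finset.sum_filter]
    refine Finset.sum_congr rfl fun σ _ => ?_
    simp only [pairTerm, pairIndex_zero, pairIndex_one]
  rw [Finset.sum_congr rfl fun σ _ => h1 σ, Finset.sum_comm, pairCount, h2]
  have h3 : ∀ x : (Fin m → Equiv.Perm (Fin 2)) × Equiv.Perm (Fin m),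
      (∑ σ, if IsPairing (σ * pairPerm x) then pairTerm A (σ * pairPerm x) else 0) =
        ∑ σ, if IsPairing σ then pairTerm A σ else 0 := fun x =>
    Equiv.sum_comp (Equiv.mulRight (pairPerm x)) fun σ => if IsPairing σ then pairTerm A σ else 0
  rw [Finset.sum_congr rfl fun x _ => h3 x]
  simp

variable {E : Type*} [AddCommGroup E] [Module ℝ E]

/-- A bilinear map as a multilinear map in two variables. -/
def bilinMultilinear (ω : E →ₗ[ℝ] E →ₗ[ℝ] ℝ) : MultilinearMap ℝ (fun _ : Fin 2 => E) ℝ where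
  toFun v := ω (v 0) (v 1)
  map_update_add' := by
    intro inst v i x y
    rw [Subsingleton.elim inst (instDecidableEqFin 2)]
    fin_cases i <;> simp
  map_update_smul' := by
    intro inst v i c x
    rw [Subsingleton.elim inst (instDecidableEqFin 2)]
    fin_cases i <;> simp

/-- The multilinear map `v ↦ ∏_a ω (v_{2a}, v_{2a+1})`. -/
def pairProd (ω : E →ₗ[ℝ] E →ₗ[ℝ] ℝ) (m : ℕ) :
    MultilinearMap ℝ (fun _ : Fin (2 * m) => E) ℝ :=
  ((MultilinearMap.mkPiAlgebra ℝ (Fin m) ℝ).compMultilinearMap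
    (fun _ => bilinMultilinear ω)).domDomCongr ((Equiv.sigmaEquivProd _ _).trans (pairIndex m))

theorem pairProd_apply (ω : E →ₗ[ℝ] E →ₗ[ℝ] ℝ) (m : ℕ) (v : Fin (2 * m) → E) :
    pairProd ω m v = ∏ a, ω (v (pairIndex m (a, 0))) (v (pairIndex m (a, 1))) := by
  simp [pairProd, bilinMultilinear, MultilinearMap.compMultilinearMap_apply]
  rfl

/-- The Pfaffian of the Gram matrix of an alternating form, as an alternating map. -/
def pfaffianAlternating (ω : E →ₗ[ℝ] E →ₗ[ℝ] ℝ) (m : ℕ) : E [⋀^Fin (2 * m)]→ₗ[ℝ] ℝ :=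
  (pairCount m)⁻¹ • MultilinearMap.alternatization (pairProd ω m)

theorem pfaffianAlternating_apply {ω : E →ₗ[ℝ] E →ₗ[ℝ] ℝ} (hω : ∀ x y, ω x y = -ω y x) (m : ℕ)
    (v : Fin (2 * m) → E) :
    pfaffianAlternating ω m v = pfaffian (Matrix.of fun i j => ω (v i) (v j)) := by
  rw [pfaffianAlternating, AlternatingMap.smul_apply, MultilinearMap.alternatization_apply,
    smul_eq_mul, inv_mul_eq_iff_eq_mul₀ (pairCount_ne_zero m),
    ← sum_pairTerm (A := Matrix.of fun i j => ω (v i) (v j)) (fun i j => hω _ _)]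
  refine Finset.sum_congr rfl fun σ _ => ?_
  rw [MultilinearMap.domDomCongr_apply, pairProd_apply, pairTerm, Units.smul_def, zsmul_eq_mul]
  rfl

/-! ### Expansion along a row with a single nonzero entry -/

theorem IsPairing.apply_zero {m : ℕ} {σ : Equiv.Perm (Fin (2 * (m + 1)))} (h : IsPairing σ) :
    σ ⟨0, by omega⟩ = ⟨0, by omega⟩ := by
  obtain ⟨i, hi⟩ := σ.surjective ⟨0, by omega⟩
  rcases Nat.even_or_odd' i.val with ⟨a, ha | ha⟩
  · have ha' : a < m + 1 := by omega
    rcases Nat.eq_zero_or_pos a with h0 | h0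
    · subst h0
      have : i = ⟨0, by omega⟩ := by ext; simp [ha]
      rwa [this] at hi
    · have := h.2 ⟨0, by omega⟩ ⟨a, ha'⟩ (by simpa [Fin.lt_def] using h0)
      have e : (⟨2 * a, by omega⟩ : Fin (2 * (m + 1))) = i := by ext; simp [ha]
      rw [e, hi] at this
      simp at this
  · have := h.1 ⟨a, by omega⟩
    have e : (⟨2 * a + 1, by omega⟩ : Fin (2 * (m + 1))) = i := by ext; simp [ha]
    rw [e, hi] at this
    simp at this

/-- The extension of a permutation by two fixed points in front. -/
def extendTwo {n : ℕ} (σ : Equiv.Perm (Fin n)) : Equiv.Perm (Fin (n + 2)) :=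
  Equiv.Perm.decomposeFin.symm (0, Equiv.Perm.decomposeFin.symm (0, σ))

theorem extendTwo_zero {n : ℕ} (σ : Equiv.Perm (Fin n)) : extendTwo σ 0 = 0 := by
  simp [extendTwo]

theorem extendTwo_one {n : ℕ} (σ : Equiv.Perm (Fin n)) : extendTwo σ 1 = 1 := by
  have : (1 : Fin (n + 2)) = Fin.succ 0 := rfl
  rw [extendTwo, this, Equiv.Perm.decomposeFin_symm_apply_succ]
  simp

theorem extendTwo_succ_succ {n : ℕ} (σ : Equiv.Perm (Fin n)) (i : Fin n) :
    extendTwo σ i.succ.succ = (σ i).succ.succ := by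
  simp [extendTwo, Equiv.Perm.decomposeFin_symm_apply_succ]

theorem isPairing_extendTwo {m : ℕ} (σ : Equiv.Perm (Fin (2 * m))) :
    IsPairing (m := m + 1) (extendTwo σ) ↔ IsPairing σ := by
  have h0 : ∀ a : Fin m, extendTwo σ (⟨2 * (a + 1), by omega⟩ : Fin (2 * m + 2)) =
      (σ ⟨2 * a, by omega⟩).succ.succ := fun a => extendTwo_succ_succ σ ⟨2 * a, by omega⟩
  have h1 : ∀ a : Fin m, extendTwo σ (⟨2 * (a + 1) + 1, by omega⟩ : Fin (2 * m + 2)) =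
      (σ ⟨2 * a + 1, by omega⟩).succ.succ := fun a => extendTwo_succ_succ σ ⟨2 * a + 1, by omega⟩
  have e0 : extendTwo σ (⟨0, by omega⟩ : Fin (2 * m + 2)) = 0 := extendTwo_zero σ
  have e1 : extendTwo σ (⟨1, by omega⟩ : Fin (2 * m + 2)) = 1 := extendTwo_one σ
  constructor
  · rintro ⟨ha, hb⟩
    refine ⟨fun a => ?_, fun a b hab => ?_⟩
    · have := ha a.succ
      simp only [Fin.val_succ] at this
      erw [h0, h1] at this
      simpa using this
    · have := hb a.succ b.succ (by simpa using hab)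
      simp only [Fin.val_succ] at this
      erw [h0, h0] at this
      simpa using this
  · rintro ⟨ha, hb⟩
    refine ⟨fun a => ?_, fun a b hab => ?_⟩
    · refine Fin.cases ?_ (fun a => ?_) a
      · erw [e0, e1]; exact Fin.zero_lt_one
      · simp only [Fin.val_succ]
        erw [h0, h1]
        simpa using ha a
    · revert hab
      refine Fin.cases ?_ (fun a => ?_) a <;> refine Fin.cases ?_ (fun b => ?_) b
      · simp
      · intro _
        simp only [Fin.val_succ]
        erw [e0, h0]
        exact Fin.succ_pos _
      · simp
      · intro hab
        simp only [Fin.val_succ]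
        erw [h0, h0]
        simpa using hb a b (by simpa using hab)

theorem pfaffian_eq_mul_of_row_zero {m : ℕ} (A : Matrix (Fin (2 * m + 2)) (Fin (2 * m + 2)) ℝ)
    (hA : ∀ j : Fin (2 * m), A 0 j.succ.succ = 0) :
    pfaffian (m := m + 1) A =
      A 0 1 * pfaffian (Matrix.of fun i j : Fin (2 * m) => A i.succ.succ j.succ.succ) := by
  classical
  have hexp : ∀ (n : ℕ) (B : Matrix (Fin (2 * n)) (Fin (2 * n)) ℝ),
      pfaffian B = ∑ σ, if IsPairing σ then pairTerm B σ else 0 := by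
    intro n B
    rw [pfaffian, Finset.sum_filter]
    refine Finset.sum_congr rfl fun σ _ => ?_
    simp only [pairTerm, pairIndex_zero, pairIndex_one]
  have hprod : ∀ σ : Equiv.Perm (Fin (2 * m + 2)), pairTerm (m := m + 1) A σ =
      ((Equiv.Perm.sign σ : ℤ) : ℝ) * (A (σ 0) (σ 1) * ∏ a : Fin m,
        A (σ (pairIndex m (a, 0)).succ.succ) (σ (pairIndex m (a, 1)).succ.succ)) := by
    intro σ
    rw [pairTerm, Fin.prod_univ_succ]
    simp only [pairIndex_zero, pairIndex_one]
    rfl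
  rw [hexp, hexp]
  refine (Equiv.sum_comp (Equiv.Perm.decomposeFin (n := 2 * m + 1)).symm (fun σ =>
    if IsPairing (m := m + 1) σ then pairTerm (m := m + 1) A σ else 0)).symm.trans ?_
  rw [Fintype.sum_prod_type, Finset.sum_eq_single 0]
  rotate_left
  · intro p _ hp
    refine Finset.sum_eq_zero fun σ _ => if_neg fun h => hp ?_
    have := h.apply_zero
    erw [Equiv.Perm.decomposeFin_symm_apply_zero] at this
    exact this
  · simp
  refine (Equiv.sum_comp (Equiv.Perm.decomposeFin (n := 2 * m)).symm (fun σ =>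
    if IsPairing (m := m + 1) (Equiv.Perm.decomposeFin.symm (0, σ)) then
      pairTerm (m := m + 1) A (Equiv.Perm.decomposeFin.symm (0, σ)) else 0)).symm.trans ?_
  rw [Fintype.sum_prod_type, Finset.sum_eq_single 0]
  rotate_left
  · intro q _ hq
    refine Finset.sum_eq_zero fun σ _ => ?_
    obtain ⟨j, rfl⟩ := Fin.exists_succ_eq.2 hq
    split_ifs with h
    · rw [hprod]
      have : (1 : Fin (2 * m + 2)) = Fin.succ 0 := rfl
      rw [Equiv.Perm.decomposeFin_symm_apply_zero, this,
        Equiv.Perm.decomposeFin_symm_apply_succ]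
      simp [hA]
    · rfl
  · simp
  rw [Finset.mul_sum]
  refine Finset.sum_congr rfl fun σ _ => ?_
  have hs : Equiv.Perm.sign (extendTwo σ) = Equiv.Perm.sign σ := by
    simp [extendTwo, Equiv.Perm.decomposeFin.symm_sign]
  change (if IsPairing (m := m + 1) (extendTwo σ) then
    pairTerm (m := m + 1) A (extendTwo σ) else 0) = _
  simp only [isPairing_extendTwo, mul_ite, mul_zero]
  congr 1
  rw [hprod, hs, extendTwo_zero, extendTwo_one]
  simp only [extendTwo_succ_succ, pairTerm, Matrix.of_apply]
  ring

end DualCubic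

namespace DualCubicString

variable {N : ℕ} (s : DualCubicString N)

/-! ### Positions, gaps and masses -/

theorem pos_zero : s.pos 0 = -1 := by simp [pos]

theorem pos_succ (i : Fin N) : s.pos (i + 1) = s.y i := by simp [pos]

theorem pos_last : s.pos (N + 1) = 1 := by simp [pos]

theorem pos_lt_pos_succ {k : ℕ} (hk : k ≤ N) : s.pos k < s.pos (k + 1) := by
  rcases Nat.eq_zero_or_pos k with rfl | h0
  · rcases Nat.eq_zero_or_pos N with rfl | hN
    · simp [pos]
    · have := s.pos_succ ⟨0, hN⟩
      simp only at this
      rw [this, pos_zero]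
      exact s.neg_one_lt _
  · have h1 := s.pos_succ ⟨k - 1, by omega⟩
    simp only [Nat.sub_add_cancel h0] at h1
    rw [h1]
    rcases hk.lt_or_eq with h | rfl
    · rw [s.pos_succ ⟨k, h⟩]
      exact s.strictMono (by simp [Fin.lt_def]; omega)
    · rw [pos_last]; exact s.lt_one _

theorem pos_le_pos {k n : ℕ} (hkn : k ≤ n) (hn : n ≤ N + 1) : s.pos k ≤ s.pos n := by
  induction n, hkn using Nat.le_induction with
  | base => rfl
  | succ n _ ih => exact (ih (by omega)).trans (s.pos_lt_pos_succ (by omega)).le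

theorem gap_pos {k : ℕ} (hk : k ≤ N) : 0 < s.gap k := sub_pos.2 (s.pos_lt_pos_succ hk)

theorem mass_pos {k : ℕ} (h1 : 1 ≤ k) (hk : k ≤ N) : 0 < s.mass k := by
  rw [mass, dif_pos ⟨h1, hk⟩]; exact s.g_pos _

theorem mass_succ (i : Fin N) : s.mass (i + 1) = s.g i := by
  rw [mass, dif_pos ⟨by omega, by omega⟩]; rfl

theorem mass_last : s.mass (N + 1) = 0 := by simp [mass]

theorem sum_gap : ∑ k ∈ Finset.range (N + 1), s.gap k = 2 := by
  simp only [gap]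
  rw [Finset.sum_range_sub, pos_last, pos_zero]; norm_num

theorem exists_mem_Ioo {x : ℝ} (hx : x ∈ Set.Icc (-1 : ℝ) 1) (hy : ∀ i, x ≠ s.y i) :
    x = -1 ∨ x = 1 ∨ ∃ k ≤ N, x ∈ Set.Ioo (s.pos k) (s.pos (k + 1)) := by
  by_contra! h
  obtain ⟨h1, h2, h3⟩ := h
  have key : ∀ k ≤ N + 1, s.pos k < x := by
    intro k
    induction k with
    | zero => intro _; rw [pos_zero]; exact lt_of_le_of_ne hx.1 (Ne.symm h1)
    | succ k ih =>
      intro hk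
      by_contra hc
      rcases (not_lt.1 hc).lt_or_eq with h4 | h4
      · exact h3 k (by omega) ⟨ih (by omega), h4⟩
      · rcases (show k ≤ N by omega).lt_or_eq with h5 | rfl
        · exact hy ⟨k, h5⟩ (h4.trans (s.pos_succ ⟨k, h5⟩))
        · exact h2 (h4.trans s.pos_last)
  have := key (N + 1) le_rfl
  rw [pos_last] at this
  exact absurd hx.2 (not_le.2 this)

/-! ### The transfer recursion -/

/-- The values of `ψ₁` and `ψ₂` to the right of `y_k`, and of `ψ₃` at `y_k`, for the solution
with `ψ(-1) = (1, 0, 0)`. -/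
def transfer (z : ℝ) : ℕ → ℝ × ℝ × ℝ
  | 0 => (1, 0, 0)
  | k + 1 =>
    let a := transfer z k
    let x₃ := a.2.2 - z * s.gap k * a.1
    let x₂ := a.2.1 + s.mass (k + 1) * x₃
    (a.1 + s.mass (k + 1) * ((a.2.1 + x₂) / 2), x₂, x₃)

/-- The first component of the transfer recursion. -/
def tr₁ (z : ℝ) (k : ℕ) : ℝ := (s.transfer z k).1

/-- The second component of the transfer recursion. -/
def tr₂ (z : ℝ) (k : ℕ) : ℝ := (s.transfer z k).2.1

/-- The third component of the transfer recursion. -/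
def tr₃ (z : ℝ) (k : ℕ) : ℝ := (s.transfer z k).2.2

theorem tr_zero (z : ℝ) : s.tr₁ z 0 = 1 ∧ s.tr₂ z 0 = 0 ∧ s.tr₃ z 0 = 0 := ⟨rfl, rfl, rfl⟩

theorem tr₁_succ (z : ℝ) (k : ℕ) : s.tr₁ z (k + 1) =
    s.tr₁ z k + s.mass (k + 1) * ((s.tr₂ z k + s.tr₂ z (k + 1)) / 2) := rfl

theorem tr₂_succ (z : ℝ) (k : ℕ) :
    s.tr₂ z (k + 1) = s.tr₂ z k + s.mass (k + 1) * s.tr₃ z (k + 1) := rfl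

theorem tr₃_succ (z : ℝ) (k : ℕ) :
    s.tr₃ z (k + 1) = s.tr₃ z k - z * s.gap k * s.tr₁ z k := rfl

theorem tr₁_last (z : ℝ) : s.tr₁ z (N + 1) = s.tr₁ z N := by
  rw [tr₁_succ, mass_last, zero_mul, add_zero]

theorem tr₂_last (z : ℝ) : s.tr₂ z (N + 1) = s.tr₂ z N := by
  rw [tr₂_succ, mass_last, zero_mul, add_zero]

theorem tr₃_eq_sum (z : ℝ) (n : ℕ) :
    s.tr₃ z n = -z * ∑ k ∈ Finset.range n, s.gap k * s.tr₁ z k := by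
  induction n with
  | zero => simp [s.tr_zero z]
  | succ n ih => rw [tr₃_succ, ih, Finset.sum_range_succ]; ring

/-- The Lagrange identity: the bilinear form `u₁ v₃ - u₂ v₂ + u₃ v₁` changes only between the
point masses. -/
theorem tr_lagrange (w z : ℝ) (n : ℕ) :
    s.tr₁ w n * s.tr₃ z n - s.tr₂ w n * s.tr₂ z n + s.tr₃ w n * s.tr₁ z n =
      -(w + z) * ∑ k ∈ Finset.range n, s.gap k * (s.tr₁ w k * s.tr₁ z k) := by
  induction n with
  | zero => simp [s.tr_zero]
  | succ n ih =>
    rw [Finset.sum_range_succ, mul_add, ← ih]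
    simp only [tr₁_succ, tr₂_succ, tr₃_succ]
    ring

/-! ### Solutions follow the transfer recursion -/

theorem eqOn_const_of_hasDerivAt_zero {f : ℝ → ℂ} {a b : ℝ}
    (hf : ∀ x ∈ Set.Ioo a b, HasDerivAt f 0 x) : ∃ c, ∀ x ∈ Set.Ioo a b, f x = c := by
  obtain ⟨c, hc⟩ := isOpen_Ioo.exists_is_const_of_deriv_eq_zero (isPreconnected_Ioo)
    (fun x hx => (hf x hx).differentiableAt.differentiableWithinAt)
    (fun x hx => (hf x hx).deriv)
  exact ⟨c, fun x hx => hc x hx⟩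

theorem limit_of_eqOn_const {f : ℝ → ℂ} {a b : ℝ} {c L : ℂ}
    (hf : ∀ x ∈ Set.Ioo a b, f x = c) {l : Filter ℝ} [l.NeBot] (hl : Set.Ioo a b ∈ l)
    (hL : Tendsto f l (𝓝 L)) : L = c := by
  refine tendsto_nhds_unique hL (tendsto_const_nhds.congr' ?_)
  filter_upwards [hl] with x hx using (hf x hx).symm

variable {s}

/-- Between two point masses, `ψ₃` is determined by `ψ₁` and its value at the left end. -/
theorem IsSolution.third_eq {z : ℝ} {ψ₁ ψ₂ ψ₃ : ℝ → ℂ} (h : s.IsSolution z ψ₁ ψ₂ ψ₃) {k : ℕ}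
    (hk : k ≤ N) {c d : ℂ} (h1 : ∀ x ∈ Set.Ioo (s.pos k) (s.pos (k + 1)), ψ₁ x = c)
    (h0 : ψ₃ (s.pos k) = d) {x : ℝ} (hx : x ∈ Set.Icc (s.pos k) (s.pos (k + 1))) :
    ψ₃ x = d - z * (x - s.pos k) * c := by
  have hlt := s.pos_lt_pos_succ hk
  have hsub : Set.Icc (s.pos k) (s.pos (k + 1)) ⊆ Set.Icc (-1) 1 := by
    rw [← s.pos_zero, ← s.pos_last]
    exact Set.Icc_subset_Icc (s.pos_le_pos (Nat.zero_le _) (by omega))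
      (s.pos_le_pos (by omega) le_rfl)
  have hder : ∀ x ∈ Set.Ioo (s.pos k) (s.pos (k + 1)),
      HasDerivAt (fun x : ℝ => ψ₃ x + z * c * (x : ℂ)) 0 x := by
    intro x hx
    have ha := (h.deriv_between k hk x hx).2.2
    rw [h1 x hx] at ha
    have hb : HasDerivAt (fun x : ℝ => (x : ℂ)) 1 x := Complex.ofRealCLM.hasDerivAt
    have := ha.add (hb.const_mul (z * c : ℂ))
    rwa [show -(z : ℂ) * c + z * c * 1 = 0 by ring] at this
  obtain ⟨e, he⟩ := eqOn_const_of_hasDerivAt_zero hder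
  have hcont : ContinuousOn (fun x : ℝ => ψ₃ x + z * c * (x : ℂ))
      (Set.Icc (s.pos k) (s.pos (k + 1))) :=
    (h.continuousOn.mono hsub).add
      (continuous_const.mul Complex.continuous_ofReal).continuousOn
  have hall : Set.EqOn (fun x : ℝ => ψ₃ x + z * c * (x : ℂ))
      (fun _ => e) (Set.Icc (s.pos k) (s.pos (k + 1))) :=
    Set.EqOn.of_subset_closure (s := Set.Ioo (s.pos k) (s.pos (k + 1)))
      (fun x hx => he x hx) hcont continuousOn_const Set.Ioo_subset_Icc_self
      (by rw [closure_Ioo hlt.ne])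
  have e1 := hall hx
  have e2 := hall (Set.left_mem_Icc.2 hlt.le)
  simp only at e1 e2
  rw [← e2, h0] at e1
  linear_combination e1

/-- The state of a solution with `ψ₂(-1) = ψ₃(-1) = 0` along the string. -/
theorem IsSolution.eq_transfer {z : ℝ} {ψ₁ ψ₂ ψ₃ : ℝ → ℂ} (h : s.IsSolution z ψ₁ ψ₂ ψ₃)
    (h2 : ψ₂ (-1) = 0) (h3 : ψ₃ (-1) = 0) {k : ℕ} (hk : k ≤ N) :
    (∀ x ∈ Set.Ioo (s.pos k) (s.pos (k + 1)),
      ψ₁ x = ψ₁ (-1) * s.tr₁ z k ∧ ψ₂ x = ψ₁ (-1) * s.tr₂ z k) ∧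
    ψ₃ (s.pos k) = ψ₁ (-1) * s.tr₃ z k ∧
    ψ₃ (s.pos (k + 1)) = ψ₁ (-1) * s.tr₃ z (k + 1) := by
  have hlt := s.pos_lt_pos_succ hk
  have hstep : (∀ x ∈ Set.Ioo (s.pos k) (s.pos (k + 1)),
      ψ₁ x = ψ₁ (-1) * s.tr₁ z k ∧ ψ₂ x = ψ₁ (-1) * s.tr₂ z k) →
      ψ₃ (s.pos k) = ψ₁ (-1) * s.tr₃ z k →
      ψ₃ (s.pos (k + 1)) = ψ₁ (-1) * s.tr₃ z (k + 1) := by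
    intro hA h0
    rw [h.third_eq hk (fun x hx => (hA x hx).1) h0 (Set.right_mem_Icc.2 hlt.le), tr₃_succ, gap]
    push_cast
    ring
  obtain ⟨c1, hc1⟩ := eqOn_const_of_hasDerivAt_zero
    (fun x hx => (h.deriv_between k hk x hx).1)
  obtain ⟨c2, hc2⟩ := eqOn_const_of_hasDerivAt_zero
    (fun x hx => (h.deriv_between k hk x hx).2.1)
  have hmem : Set.Ioo (s.pos k) (s.pos (k + 1)) ∈ 𝓝[>] (s.pos k) := Ioo_mem_nhdsGT hlt
  suffices hs : c1 = ψ₁ (-1) * s.tr₁ z k ∧ c2 = ψ₁ (-1) * s.tr₂ z k ∧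
      ψ₃ (s.pos k) = ψ₁ (-1) * s.tr₃ z k by
    have hA : ∀ x ∈ Set.Ioo (s.pos k) (s.pos (k + 1)),
        ψ₁ x = ψ₁ (-1) * s.tr₁ z k ∧ ψ₂ x = ψ₁ (-1) * s.tr₂ z k := fun x hx =>
      ⟨(hc1 x hx).trans hs.1, (hc2 x hx).trans hs.2.1⟩
    exact ⟨hA, hs.2.2, hstep hA hs.2.2⟩
  clear hstep
  induction k generalizing c1 c2 with
  | zero =>
    rw [s.pos_zero] at hmem
    have e1 := limit_of_eqOn_const (by rwa [s.pos_zero] at hc1) hmem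
      (h.left_end.1.tendsto.mono_left (nhdsWithin_mono _ Set.Ioi_subset_Ici_self))
    have e2 := limit_of_eqOn_const (by rwa [s.pos_zero] at hc2) hmem
      (h.left_end.2.tendsto.mono_left (nhdsWithin_mono _ Set.Ioi_subset_Ici_self))
    rw [s.pos_zero, h3, ← e1, ← e2, h2, (s.tr_zero z).1, (s.tr_zero z).2.1, (s.tr_zero z).2.2]
    simp
  | succ k ih =>
    have hk' : k ≤ N := by omega
    have hlt' := s.pos_lt_pos_succ hk'
    obtain ⟨d1, hd1⟩ := eqOn_const_of_hasDerivAt_zero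
      (fun x hx => (h.deriv_between k hk' x hx).1)
    obtain ⟨d2, hd2⟩ := eqOn_const_of_hasDerivAt_zero
      (fun x hx => (h.deriv_between k hk' x hx).2.1)
    obtain ⟨i1, i2, i3⟩ := ih hk' hlt' d1 hd1 d2 hd2 (Ioo_mem_nhdsGT hlt')
    have hmem' : Set.Ioo (s.pos k) (s.pos (k + 1)) ∈ 𝓝[<] (s.pos (k + 1)) := Ioo_mem_nhdsLT hlt'
    have t3 : ψ₃ (s.pos (k + 1)) = ψ₁ (-1) * s.tr₃ z (k + 1) := by
      rw [h.third_eq hk' (fun x hx => (hd1 x hx).trans i1) i3 (Set.right_mem_Icc.2 hlt'.le),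
        tr₃_succ, gap]
      push_cast
      ring
    obtain ⟨L₁, R₁, L₂, R₂, hL1, hR1, hL2, hR2, hj1, hj2⟩ := h.jump (k + 1) (by omega) hk
    have a1 := limit_of_eqOn_const hd1 hmem' hL1
    have a2 := limit_of_eqOn_const hd2 hmem' hL2
    have a3 := limit_of_eqOn_const hc1 hmem hR1
    have a4 := limit_of_eqOn_const hc2 hmem hR2
    subst a1 a2 a3 a4
    have t2 : R₂ = ψ₁ (-1) * s.tr₂ z (k + 1) := by
      rw [tr₂_succ]; push_cast
      rw [t3, i2] at hj2
      linear_combination hj2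
    refine ⟨?_, t2, t3⟩
    rw [tr₁_succ]; push_cast
    rw [i1, i2, t2] at hj1
    linear_combination hj1

theorem IsSolution.eq_transfer_right {z : ℝ} {ψ₁ ψ₂ ψ₃ : ℝ → ℂ} (h : s.IsSolution z ψ₁ ψ₂ ψ₃)
    (h2 : ψ₂ (-1) = 0) (h3 : ψ₃ (-1) = 0) :
    ψ₁ 1 = ψ₁ (-1) * s.tr₁ z N ∧ ψ₂ 1 = ψ₁ (-1) * s.tr₂ z N ∧
      ψ₃ 1 = ψ₁ (-1) * s.tr₃ z (N + 1) := by
  obtain ⟨hA, -, hC⟩ := h.eq_transfer h2 h3 le_rfl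
  have hlt := s.pos_lt_pos_succ (le_refl N)
  have hmem : Set.Ioo (s.pos N) (s.pos (N + 1)) ∈ 𝓝[<] (s.pos (N + 1)) := Ioo_mem_nhdsLT hlt
  rw [s.pos_last] at hmem hA hC
  exact ⟨limit_of_eqOn_const (fun x hx => (hA x hx).1) hmem
      (h.right_end.1.tendsto.mono_left (nhdsWithin_mono _ Set.Iio_subset_Iic_self)),
    limit_of_eqOn_const (fun x hx => (hA x hx).2) hmem
      (h.right_end.2.tendsto.mono_left (nhdsWithin_mono _ Set.Iio_subset_Iic_self)), hC⟩

theorem IsEigenvalue.tr₃_eq_zero {z : ℝ} (h : s.IsEigenvalue z) : s.tr₃ z (N + 1) = 0 := by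
  obtain ⟨ψ₁, ψ₂, ψ₃, hs, h2, h3, h4, x, hx, hy, hne⟩ := h
  have hr := hs.eq_transfer_right h2 h3
  have hc : ψ₁ (-1) ≠ 0 := by
    intro hc
    rw [hc] at hr
    rcases s.exists_mem_Ioo hx hy with rfl | rfl | ⟨k, hk, hxk⟩
    · simp [hc, h2, h3] at hne
    · simp [hr] at hne
    · obtain ⟨hA, hB, -⟩ := hs.eq_transfer h2 h3 hk
      have := hs.third_eq hk (fun x hx => (hA x hx).1) hB (Set.Ioo_subset_Icc_self hxk)
      simp [hA x hxk, this, hc] at hne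
  rw [hr.2.2] at h4
  exact_mod_cast (mul_eq_zero.1 h4).resolve_left hc

theorem IsWeylValue.tr_eq {z w : ℝ} (h : s.IsWeylValue z w) :
    s.tr₃ z (N + 1) ≠ 0 ∧ w = -s.tr₂ z N / s.tr₃ z (N + 1) := by
  obtain ⟨ψ₁, ψ₂, ψ₃, hs, h1, h2, h3, h4, hw⟩ := h
  have hr := hs.eq_transfer_right h2 h3
  rw [h1, one_mul, one_mul, one_mul] at hr
  rw [hr.2.2] at h4
  rw [hr.2.2, hr.2.1] at hw
  exact ⟨by exact_mod_cast h4, by exact_mod_cast hw⟩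

/-! ### The normalised eigenfunctions -/

section Spectral

variable {ζ b : Fin N → ℝ}

theorem HasSpectralData.tr₃_eq_zero (hs : s.HasSpectralData ζ b) (j : Fin N) :
    s.tr₃ (ζ j) (N + 1) = 0 :=
  IsEigenvalue.tr₃_eq_zero ((hs.spectrum _).2 (Or.inr ⟨j, rfl⟩))

theorem HasSpectralData.weyl_neg (hs : s.HasSpectralData ζ b) (hζ : ∀ j, 0 < ζ j) (j : Fin N) :
    s.tr₃ (-ζ j) (N + 1) ≠ 0 ∧
      ∑ i, b i / (ζ i + ζ j) = s.tr₂ (-ζ j) N / s.tr₃ (-ζ j) (N + 1) := by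
  have hne : ¬ s.IsEigenvalue ((-ζ j : ℝ) : ℂ) := by
    rw [hs.spectrum]
    rintro (h | ⟨i, hi⟩)
    · have : -ζ j = 0 := by exact_mod_cast h
      linarith [hζ j]
    · have : -ζ j = ζ i := by exact_mod_cast hi
      linarith [hζ j, hζ i]
  have hw := hs.weyl _ hne
  have e : (∑ i, (b i : ℂ) / (((-ζ j : ℝ) : ℂ) - (ζ i : ℂ))) =
      ((∑ i, b i / (-ζ j - ζ i) : ℝ) : ℂ) := by push_cast; rfl
  rw [e] at hw
  obtain ⟨h1, h2⟩ := IsWeylValue.tr_eq hw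
  refine ⟨h1, ?_⟩
  rw [neg_div] at h2
  rw [← neg_eq_iff_eq_neg.2 h2, ← Finset.sum_neg_distrib]
  refine Finset.sum_congr rfl fun i _ => ?_
  rw [← div_neg]
  congr 1
  ring

theorem tr_backward {z : ℝ} {n : ℕ} (h1 : s.tr₁ z n = 0) (h2 : s.tr₂ z n = 0)
    (h3 : s.tr₃ z n = 0) : False := by
  induction n with
  | zero => exact one_ne_zero h1
  | succ n ih =>
    have e2 : s.tr₂ z n = 0 := by rw [tr₂_succ, h3] at h2; linarith
    have e1 : s.tr₁ z n = 0 := by rw [tr₁_succ, h2, e2] at h1; linarith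
    exact ih e1 e2 (by rw [tr₃_succ, e1] at h3; linarith)

theorem HasSpectralData.tr₁_eq (hs : s.HasSpectralData ζ b) (hζ : ∀ j, 0 < ζ j) (j : Fin N) :
    s.tr₁ (ζ j) N = s.tr₂ (ζ j) N * ∑ i, b i / (ζ i + ζ j) := by
  obtain ⟨h1, h2⟩ := hs.weyl_neg hζ j
  have h := s.tr_lagrange (ζ j) (-ζ j) (N + 1)
  rw [hs.tr₃_eq_zero j, tr₁_last, tr₁_last, tr₂_last, tr₂_last] at h
  rw [h2]
  field_simp
  linarith

theorem HasSpectralData.tr₂_ne_zero (hs : s.HasSpectralData ζ b) (hζ : ∀ j, 0 < ζ j)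
    (j : Fin N) : s.tr₂ (ζ j) N ≠ 0 := by
  intro h2
  refine tr_backward (s := s) (z := ζ j) (n := N + 1) ?_ ?_ (hs.tr₃_eq_zero j)
  · rw [tr₁_last, hs.tr₁_eq hζ, h2, zero_mul]
  · rw [tr₂_last, h2]

end Spectral

end DualCubicString

namespace DualCubic

open Polynomial

/-! ### Discrete integrals and the Cauchy kernel -/

section Cauchy

variable {N : ℕ} {ζ b : Fin N → ℝ}

/-- The integral of a function against `∑_j b_j δ_{ζ_j}`. -/
def mean (b u : Fin N → ℝ) : ℝ := ∑ j, b j * u j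

/-- The Cauchy transform `∫ u(x) / (x + ζ_j) dμ(x)`. -/
def cauchy (ζ b u : Fin N → ℝ) (j : Fin N) : ℝ := ∑ i, b i * u i / (ζ i + ζ j)

theorem mean_add (u v : Fin N → ℝ) : mean b (u + v) = mean b u + mean b v := by
  simp [mean, mul_add, Finset.sum_add_distrib]

theorem mean_sub (u v : Fin N → ℝ) : mean b (u - v) = mean b u - mean b v := by
  simp [mean, mul_sub, Finset.sum_sub_distrib]

theorem mean_smul (c : ℝ) (u : Fin N → ℝ) : mean b (c • u) = c * mean b u := by
  simp only [mean, Pi.smul_apply, smul_eq_mul, Finset.mul_sum]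
  exact Finset.sum_congr rfl fun _ _ => by ring

theorem mean_sum {ι : Type*} (t : Finset ι) (u : ι → Fin N → ℝ) :
    mean b (∑ i ∈ t, u i) = ∑ i ∈ t, mean b (u i) := by
  simp only [mean, Finset.sum_apply, Finset.mul_sum]
  exact Finset.sum_comm

theorem cauchy_add (u v : Fin N → ℝ) : cauchy ζ b (u + v) = cauchy ζ b u + cauchy ζ b v := by
  ext j; simp [cauchy, mul_add, add_div, Finset.sum_add_distrib]

theorem cauchy_smul (c : ℝ) (u : Fin N → ℝ) : cauchy ζ b (c • u) = c • cauchy ζ b u := by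
  ext j
  simp only [cauchy, Pi.smul_apply, smul_eq_mul, Finset.mul_sum]
  exact Finset.sum_congr rfl fun _ _ => by ring

theorem mean_mul_cauchy (u v : Fin N → ℝ) :
    mean b (u * cauchy ζ b v) = ∑ i, ∑ j, b i * b j * (u i * v j / (ζ i + ζ j)) := by
  simp only [mean, cauchy, Pi.mul_apply, Finset.mul_sum]
  refine Finset.sum_congr rfl fun i _ => Finset.sum_congr rfl fun j _ => ?_
  rw [add_comm (ζ j)]; ring

theorem mean_mul_cauchy_comm (u v : Fin N → ℝ) :
    mean b (u * cauchy ζ b v) = mean b (v * cauchy ζ b u) := by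
  rw [mean_mul_cauchy, mean_mul_cauchy, Finset.sum_comm]
  refine Finset.sum_congr rfl fun i _ => Finset.sum_congr rfl fun j _ => ?_
  rw [add_comm (ζ j)]; ring

theorem mul_cauchy (hζ : ∀ j, 0 < ζ j) (u : Fin N → ℝ) (j : Fin N) :
    ζ j * cauchy ζ b u j = mean b u - cauchy ζ b (ζ * u) j := by
  simp only [mean, cauchy, Finset.mul_sum, ← Finset.sum_sub_distrib, Pi.mul_apply]
  refine Finset.sum_congr rfl fun i _ => ?_
  have : ζ i + ζ j ≠ 0 := (add_pos (hζ i) (hζ j)).ne'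
  field_simp
  ring

theorem mean_mul_mul_cauchy_add (hζ : ∀ j, 0 < ζ j) (u v : Fin N → ℝ) :
    mean b (u * (ζ * cauchy ζ b v)) + mean b (v * (ζ * cauchy ζ b u)) =
      mean b u * mean b v := by
  have h : ζ * cauchy ζ b u = (fun _ => mean b u) - cauchy ζ b (ζ * u) :=
    funext fun j => mul_cauchy hζ u j
  rw [h, mul_sub, mean_sub, mean_mul_cauchy_comm v,
    show u * (ζ * cauchy ζ b v) = ζ * u * cauchy ζ b v by ring,
    show v * (fun _ => mean b u) = mean b u • v by ext; simp [mul_comm], mean_smul]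
  ring

/-- The Cauchy matrix `1 / (ζ_i + ζ_j)` is nonsingular. -/
theorem eq_zero_of_cauchy_eq_zero (hζ : ∀ j, 0 < ζ j) (hinj : Function.Injective ζ)
    {v : Fin N → ℝ} (hv : ∀ j, ∑ i, v i / (ζ i + ζ j) = 0) : v = 0 := by
  classical
  set P : ℝ[X] := ∑ i, C (v i) * ∏ k ∈ Finset.univ.erase i, (X + C (ζ k)) with hP
  have hdeg : P.degree < (Finset.univ.image ζ).card := by
    rw [Finset.card_image_of_injective _ hinj]
    refine (Polynomial.degree_sum_le _ _).trans_lt ?_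
    rw [Finset.sup_lt_iff (by
      rw [bot_lt_iff_ne_bot]; exact WithBot.coe_ne_bot)]
    intro i _
    rw [← smul_eq_C_mul]
    refine (Polynomial.degree_smul_le _ _).trans_lt ?_
    rw [Polynomial.degree_prod]
    simp only [Polynomial.degree_X_add_C, Finset.sum_const, Finset.card_erase_of_mem
      (Finset.mem_univ i)]
    have : 0 < (Finset.univ : Finset (Fin N)).card := Finset.card_pos.2 ⟨i, Finset.mem_univ _⟩
    rw [nsmul_one]
    exact_mod_cast Nat.sub_lt this one_pos
  have hzero : P = 0 := by
    refine Polynomial.eq_zero_of_degree_lt_of_eval_finset_eq_zero _ hdeg ?_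
    intro x hx
    obtain ⟨j, -, rfl⟩ := Finset.mem_image.1 hx
    have : P.eval (ζ j) = (∏ k, (ζ j + ζ k)) * ∑ i, v i / (ζ i + ζ j) := by
      rw [hP, Polynomial.eval_finsetSum, Finset.mul_sum]
      refine Finset.sum_congr rfl fun i _ => ?_
      rw [← Finset.mul_prod_erase _ _ (Finset.mem_univ i)]
      have : ζ i + ζ j ≠ 0 := (add_pos (hζ i) (hζ j)).ne'
      simp only [eval_mul, eval_C, eval_prod, eval_add, eval_X]
      rw [add_comm (ζ j) (ζ i)]
      field_simp
    rw [this, hv, mul_zero]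
  ext i
  have h := congrArg (Polynomial.eval (-ζ i)) hzero
  rw [hP, Polynomial.eval_finsetSum, Finset.sum_eq_single i] at h
  · simp only [eval_mul, eval_C, eval_prod, eval_add, eval_X, eval_zero] at h
    refine (mul_eq_zero.1 h).resolve_right (Finset.prod_ne_zero_iff.2 fun k hk => ?_)
    have := hinj.ne (Finset.ne_of_mem_erase hk)
    intro h0
    exact this (by linarith)
  · intro k _ hk
    simp only [eval_mul, eval_C, eval_prod, eval_add, eval_X]
    rw [Finset.prod_eq_zero (Finset.mem_erase.2 ⟨hk.symm, Finset.mem_univ i⟩) (by ring), mul_zero]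
  · simp

end Cauchy

/-! ### Eigenfunctions read from the right end -/

/-- The eigenfunctions of a string, normalised by `ψ₂(1) = 1` and read from the right end:
`L_m` and `γ_m` are the gaps and masses counted from the right, `G₁ m`, `G₂ m` are the values of
`ψ₁`, `ψ₂` on the `m`-th gap and `G₃ m` those of `ψ₃` at its right end. -/
structure EigenData {N : ℕ} (ζ b : Fin N → ℝ) (L γ : ℕ → ℝ) (G₁ G₂ G₃ : ℕ → Fin N → ℝ) :
    Prop where
  ζ_pos : ∀ j, 0 < ζ j
  ζ_inj : Function.Injective ζ
  L_pos : ∀ m ≤ N, 0 < L m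
  γ_pos : ∀ m < N, 0 < γ m
  sum_L : ∑ m ∈ Finset.range (N + 1), L m = 2
  G₁_zero : G₁ 0 = cauchy ζ b 1
  G₂_zero : G₂ 0 = 1
  G₃_zero : G₃ 0 = 0
  G₃_succ : ∀ m < N, G₃ (m + 1) = G₃ m + L m • (ζ * G₁ m)
  G₂_succ : ∀ m < N, G₂ (m + 1) = G₂ m - γ m • G₃ (m + 1)
  G₁_succ : ∀ m < N, G₁ (m + 1) = G₁ m - (γ m / 2) • (G₂ m + G₂ (m + 1))
  G₂_last : G₂ N = 0
  orth : ∀ i j, ∑ m ∈ Finset.range (N + 1), L m * (G₁ m i * G₁ m j) = 1 / (ζ i + ζ j)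
  orth_one : ∀ j, ∑ m ∈ Finset.range (N + 1), L m * G₁ m j = 0

theorem eigenData_of_hasSpectralData {N : ℕ} {ζ b : Fin N → ℝ} {s : DualCubicString N}
    (hs : s.HasSpectralData ζ b) (hζ : StrictMono ζ) (hζ_pos : ∀ j, 0 < ζ j) :
    EigenData ζ b (fun m => s.gap (N - m)) (fun m => s.mass (N - m))
      (fun m j => s.tr₁ (ζ j) (N - m) / s.tr₂ (ζ j) N)
      (fun m j => s.tr₂ (ζ j) (N - m) / s.tr₂ (ζ j) N)
      (fun m j => s.tr₃ (ζ j) (N + 1 - m) / s.tr₂ (ζ j) N) where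
  ζ_pos := hζ_pos
  ζ_inj := hζ.injective
  L_pos m _ := s.gap_pos (Nat.sub_le _ _)
  γ_pos m hm := s.mass_pos (by omega) (Nat.sub_le _ _)
  sum_L := by
    rw [← s.sum_gap, ← Finset.sum_range_reflect]
    refine Finset.sum_congr rfl fun m hm => ?_
    rw [show N - (N + 1 - 1 - m) = m by have := Finset.mem_range.1 hm; omega]
  G₁_zero := by
    ext j
    have := hs.tr₂_ne_zero hζ_pos j
    simp only [Nat.sub_zero, hs.tr₁_eq hζ_pos, cauchy, Pi.one_apply, mul_one]
    field_simp
  G₂_zero := by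
    ext j
    simp [div_self (hs.tr₂_ne_zero hζ_pos j)]
  G₃_zero := by
    ext j
    simp [hs.tr₃_eq_zero]
  G₃_succ m hm := by
    ext j
    have h := s.tr₃_succ (ζ j) (N - m)
    rw [show N - m + 1 = N + 1 - m by omega] at h
    simp only [Pi.add_apply, Pi.smul_apply, Pi.mul_apply, smul_eq_mul]
    rw [h, show N + 1 - (m + 1) = N - m by omega]
    ring
  G₂_succ m hm := by
    ext j
    have h := s.tr₂_succ (ζ j) (N - (m + 1))
    rw [show N - (m + 1) + 1 = N - m by omega] at h
    simp only [Pi.sub_apply, Pi.smul_apply, smul_eq_mul]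
    rw [h, show N + 1 - (m + 1) = N - m by omega]
    ring
  G₁_succ m hm := by
    ext j
    have h := s.tr₁_succ (ζ j) (N - (m + 1))
    rw [show N - (m + 1) + 1 = N - m by omega] at h
    simp only [Pi.add_apply, Pi.sub_apply, Pi.smul_apply, smul_eq_mul]
    rw [h]
    ring
  G₂_last := by
    ext j
    simp [(s.tr_zero _).2.1]
  orth i j := by
    have h := s.tr_lagrange (ζ i) (ζ j) (N + 1)
    rw [hs.tr₃_eq_zero, hs.tr₃_eq_zero, DualCubicString.tr₂_last, DualCubicString.tr₂_last] at h
    have h1 := hs.tr₂_ne_zero hζ_pos i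
    have h2 := hs.tr₂_ne_zero hζ_pos j
    have h3 : ζ i + ζ j ≠ 0 := (add_pos (hζ_pos i) (hζ_pos j)).ne'
    have h4 : ∑ m ∈ Finset.range (N + 1), s.gap (N - m) * (s.tr₁ (ζ i) (N - m) / s.tr₂ (ζ i) N *
        (s.tr₁ (ζ j) (N - m) / s.tr₂ (ζ j) N)) = (∑ k ∈ Finset.range (N + 1),
        s.gap k * (s.tr₁ (ζ i) k * s.tr₁ (ζ j) k)) / (s.tr₂ (ζ i) N * s.tr₂ (ζ j) N) := by
      rw [Finset.sum_div, ← Finset.sum_range_reflect]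
      refine Finset.sum_congr rfl fun m hm => ?_
      rw [show N + 1 - 1 - m = N - m by omega,
        show N - (N - m) = m by have := Finset.mem_range.1 hm; omega]
      field_simp
    rw [h4, div_eq_div_iff (mul_ne_zero h1 h2) h3]
    linarith
  orth_one j := by
    have h := s.tr₃_eq_sum (ζ j) (N + 1)
    rw [hs.tr₃_eq_zero] at h
    have h4 : ∑ m ∈ Finset.range (N + 1), s.gap (N - m) * (s.tr₁ (ζ j) (N - m) / s.tr₂ (ζ j) N) =
        (∑ k ∈ Finset.range (N + 1), s.gap k * s.tr₁ (ζ j) k) / s.tr₂ (ζ j) N := by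
      rw [Finset.sum_div, ← Finset.sum_range_reflect]
      refine Finset.sum_congr rfl fun m hm => ?_
      rw [show N + 1 - 1 - m = N - m by omega,
        show N - (N - m) = m by have := Finset.mem_range.1 hm; omega]
      field_simp
    rw [h4]
    have : ∑ k ∈ Finset.range (N + 1), s.gap k * s.tr₁ (ζ j) k = 0 :=
      (mul_eq_zero.1 h.symm).resolve_left (neg_ne_zero.2 (hζ_pos j).ne')
    rw [this, zero_div]

namespace EigenData

variable {N : ℕ} {ζ b : Fin N → ℝ} {L γ : ℕ → ℝ} {G₁ G₂ G₃ : ℕ → Fin N → ℝ}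

/-- A function on the gaps that is orthogonal to the constants and to all eigenfunctions
vanishes. -/
theorem eq_zero_of_orth (h : EigenData ζ b L γ G₁ G₂ G₃) {f : ℕ → ℝ}
    (h1 : ∑ m ∈ Finset.range (N + 1), L m * f m = 0)
    (hG : ∀ j, ∑ m ∈ Finset.range (N + 1), L m * (f m * G₁ m j) = 0) {m : ℕ} (hm : m ≤ N) :
    f m = 0 := by
  set v : Option (Fin N) → Fin (N + 1) → ℝ := fun o m => o.elim 1 fun j => G₁ m j with hv
  have hli : LinearIndependent ℝ v := by
    rw [Fintype.linearIndependent_iff]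
    intro c hc
    have hc' : ∀ m ∈ Finset.range (N + 1), c none + ∑ j, c (some j) * G₁ m j = 0 := by
      intro m hm
      have := congrFun hc ⟨m, Finset.mem_range.1 hm⟩
      simpa [hv, Fintype.sum_option] using this
    have h0 : c none = 0 := by
      have : ∑ m ∈ Finset.range (N + 1), L m * (c none + ∑ j, c (some j) * G₁ m j) = 0 :=
        Finset.sum_eq_zero fun m hm => by rw [hc' m hm, mul_zero]
      simp only [mul_add, Finset.sum_add_distrib, Finset.mul_sum] at this
      rw [← Finset.sum_mul, h.sum_L, Finset.sum_comm] at this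
      have e : ∀ j, ∑ m ∈ Finset.range (N + 1), L m * (c (some j) * G₁ m j) = 0 := fun j => by
        rw [← mul_zero (c (some j)), ← h.orth_one j, Finset.mul_sum]
        exact Finset.sum_congr rfl fun _ _ => by ring
      rw [Finset.sum_congr rfl fun j _ => e j] at this
      simpa using this
    have hs : (fun j => c (some j)) = 0 := by
      refine eq_zero_of_cauchy_eq_zero h.ζ_pos h.ζ_inj fun i => ?_
      have : ∑ m ∈ Finset.range (N + 1), L m * G₁ m i * (c none + ∑ j, c (some j) * G₁ m j) = 0 :=
        Finset.sum_eq_zero fun m hm => by rw [hc' m hm, mul_zero]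
      simp only [h0, zero_add, Finset.mul_sum] at this
      rw [Finset.sum_comm] at this
      rw [← this]
      refine Finset.sum_congr rfl fun j _ => ?_
      rw [div_eq_mul_one_div, ← h.orth j i, Finset.mul_sum]
      exact Finset.sum_congr rfl fun _ _ => by ring
    intro o
    cases o with
    | none => exact h0
    | some j => exact congrFun hs j
  have hspan := hli.span_eq_top_of_card_eq_finrank (by simp)
  have hmem : (fun m : Fin (N + 1) => f m) ∈ Submodule.span ℝ (Set.range v) := by
    rw [hspan]; trivial
  have hort : ∀ g ∈ Submodule.span ℝ (Set.range v),
      ∑ m : Fin (N + 1), L m * (f m * g m) = 0 := by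
    intro g hg
    induction hg using Submodule.span_induction with
    | mem g hg =>
      obtain ⟨o, rfl⟩ := hg
      cases o with
      | none =>
        rw [Finset.sum_range] at h1
        simpa [hv] using h1
      | some j =>
        have := hG j
        rw [Finset.sum_range] at this
        simpa [hv] using this
    | zero => simp
    | add x y _ _ hx hy => simp [mul_add, Finset.sum_add_distrib, hx, hy]
    | smul a x _ hx =>
      rw [← mul_zero a, ← hx, Finset.mul_sum]
      refine Finset.sum_congr rfl fun m _ => ?_
      simp only [Pi.smul_apply, smul_eq_mul]; ring
  have hfin := hort _ hmem
  have := (Finset.sum_eq_zero_iff_of_nonneg fun m : Fin (N + 1) => fun _ =>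
    mul_nonneg (h.L_pos m (by omega)).le (mul_self_nonneg (f m))).1 hfin ⟨m, by omega⟩ (Finset.mem_univ _)
  simpa [(h.L_pos m hm).ne'] using this

theorem mean_mul_G₁ (h : EigenData ζ b L γ G₁ G₂ G₃) {i : ℕ} (hi : i ≤ N) {w : Fin N → ℝ}
    (hw : G₁ i = cauchy ζ b w) {m : ℕ} (hm : m ≤ N) :
    mean b (w * G₁ m) = (if m = i then 1 / L i else 0) - 1 / 2 := by
  have hLi := (h.L_pos i hi).ne'
  have hmemi : i ∈ Finset.range (N + 1) := Finset.mem_range.2 (by omega)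
  have key := h.eq_zero_of_orth
    (f := fun m => mean b (w * G₁ m) + (1 / 2 - if m = i then 1 / L i else 0)) ?_ ?_ hm
  · linarith
  · simp only [mul_add, Finset.sum_add_distrib, mul_sub, Finset.sum_sub_distrib, mean,
      Finset.mul_sum, Pi.mul_apply]
    rw [Finset.sum_comm, ← Finset.sum_mul, h.sum_L, Finset.sum_eq_zero]
    · simp [Finset.sum_ite_eq', hmemi, hLi]
    · intro j _
      rw [← mul_zero (b j * w j), ← h.orth_one j, Finset.mul_sum]
      exact Finset.sum_congr rfl fun _ _ => by ring
  · intro j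
    simp only [mul_add, add_mul, sub_mul, Finset.sum_add_distrib, mul_sub,
      Finset.sum_sub_distrib, mean, Finset.mul_sum, Finset.sum_mul, Pi.mul_apply]
    rw [Finset.sum_comm]
    have e1 : ∑ m ∈ Finset.range (N + 1), L m * (1 / 2 * G₁ m j) = 0 := by
      rw [← mul_zero (1 / 2 : ℝ), ← h.orth_one j, Finset.mul_sum]
      exact Finset.sum_congr rfl fun _ _ => by ring
    have e2 : ∑ m ∈ Finset.range (N + 1), L m * ((if m = i then 1 / L i else 0) * G₁ m j) =
        G₁ i j := by
      simp only [ite_mul, zero_mul, mul_ite, mul_zero]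
      rw [Finset.sum_ite_eq', if_pos hmemi]
      field_simp
    have e3 : ∑ l, ∑ m ∈ Finset.range (N + 1), L m * (b l * (w l * G₁ m l) * G₁ m j) =
        G₁ i j := by
      rw [hw, cauchy]
      refine Finset.sum_congr rfl fun l _ => ?_
      rw [div_eq_mul_one_div, ← h.orth l j, Finset.mul_sum]
      exact Finset.sum_congr rfl fun _ _ => by ring
    rw [e1, e2, e3]; ring

theorem mean_mul_G₂_add (h : EigenData ζ b L γ G₁ G₂ G₃) {m : ℕ} (hm : m < N) (w : Fin N → ℝ) :
    γ m / 2 * (mean b (w * G₂ m) + mean b (w * G₂ (m + 1))) =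
      mean b (w * G₁ m) - mean b (w * G₁ (m + 1)) := by
  rw [h.G₁_succ m hm, mul_sub, mean_sub, mul_smul_comm, mean_smul, mul_add w, mean_add]
  ring

theorem mean_mul_G₂_eq_zero (h : EigenData ζ b L γ G₁ G₂ G₃) {i : ℕ} {w : Fin N → ℝ}
    (hw : G₁ i = cauchy ζ b w) {m : ℕ} (him : i < m) (hm : m ≤ N) : mean b (w * G₂ m) = 0 := by
  induction hd : N - m generalizing m with
  | zero =>
    obtain rfl : m = N := by omega
    rw [h.G₂_last, mul_zero]; simp [mean]
  | succ d ih =>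
    have e := h.mean_mul_G₂_add (show m < N by omega) w
    rw [ih (m := m + 1) (by omega) (by omega) (by omega),
      h.mean_mul_G₁ (by omega) hw hm, h.mean_mul_G₁ (by omega) hw (by omega),
      if_neg (by omega), if_neg (by omega)] at e
    have := (h.γ_pos m (by omega)).ne'
    simpa [this] using e

theorem mean_mul_G₂_self (h : EigenData ζ b L γ G₁ G₂ G₃) {i : ℕ} {w : Fin N → ℝ}
    (hw : G₁ i = cauchy ζ b w) (hi : i < N) : γ i * L i * mean b (w * G₂ i) = 2 := by
  have e := h.mean_mul_G₂_add hi w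
  rw [h.mean_mul_G₂_eq_zero hw (Nat.lt_succ_self i) hi, h.mean_mul_G₁ hi.le hw hi.le,
    h.mean_mul_G₁ hi.le hw hi, if_pos rfl, if_neg (by omega)] at e
  have := (h.L_pos i hi.le).ne'
  field_simp at e
  linarith

end EigenData

/-! ### The polynomials attached to a string -/

section Polys

variable (L γ : ℕ → ℝ)

/-- The polynomials `(p_m, r_m, s_m)` with `s_{m+1} = s_m + L_m p_m`, `r_{m+1} = r_m + γ_m s_{m+1}`
and `p_{m+1} = p_m - γ_m x (r_m + r_{m+1}) / 2`. -/
def dualPoly : ℕ → ℝ[X] × ℝ[X] × ℝ[X]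
  | 0 => (1, 0, 0)
  | m + 1 =>
    let a := dualPoly m
    let s := a.2.2 + L m • a.1
    let r := a.2.1 + γ m • s
    (a.1 - (γ m / 2) • (X * (a.2.1 + r)), r, s)

/-- The first of the three polynomials. -/
def pPoly (m : ℕ) : ℝ[X] := (dualPoly L γ m).1

/-- The second of the three polynomials. -/
def rPoly (m : ℕ) : ℝ[X] := (dualPoly L γ m).2.1

/-- The third of the three polynomials. -/
def sPoly (m : ℕ) : ℝ[X] := (dualPoly L γ m).2.2

theorem pPoly_zero : pPoly L γ 0 = 1 := rfl
theorem rPoly_zero : rPoly L γ 0 = 0 := rfl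
theorem sPoly_zero : sPoly L γ 0 = 0 := rfl

theorem sPoly_succ (m : ℕ) : sPoly L γ (m + 1) = sPoly L γ m + L m • pPoly L γ m := rfl

theorem rPoly_succ (m : ℕ) : rPoly L γ (m + 1) = rPoly L γ m + γ m • sPoly L γ (m + 1) := rfl

theorem pPoly_succ (m : ℕ) : pPoly L γ (m + 1) =
    pPoly L γ m - (γ m / 2) • (X * (rPoly L γ m + rPoly L γ (m + 1))) := rfl

theorem coeff_eq_zero (m : ℕ) : (∀ i, m < i → (pPoly L γ m).coeff i = 0) ∧
    (∀ i, m ≤ i → (rPoly L γ m).coeff i = 0) ∧ ∀ i, m ≤ i → (sPoly L γ m).coeff i = 0 := by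
  induction m with
  | zero =>
    refine ⟨fun i hi => ?_, fun i _ => rfl, fun i _ => rfl⟩
    rw [pPoly_zero, coeff_one, if_neg (by omega)]
  | succ m ih =>
    obtain ⟨hp, hr, hs⟩ := ih
    have hs' : ∀ i, m + 1 ≤ i → (sPoly L γ (m + 1)).coeff i = 0 := fun i hi => by
      simp [sPoly_succ, hs i (by omega), hp i (by omega)]
    have hr' : ∀ i, m + 1 ≤ i → (rPoly L γ (m + 1)).coeff i = 0 := fun i hi => by
      simp [rPoly_succ, hr i (by omega), hs' i hi]
    refine ⟨fun i hi => ?_, hr', hs'⟩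
    obtain ⟨i, rfl⟩ : ∃ k, i = k + 1 := ⟨i - 1, by omega⟩
    simp [pPoly_succ, hp _ (show m < i + 1 by omega), hr i (by omega), hr' i (by omega)]

/-- The absolute value of the leading coefficient of `p_m`. -/
def leadAbs (m : ℕ) : ℝ := ∏ i ∈ Finset.range m, L i * γ i ^ 2 / 2

theorem coeff_lead (m : ℕ) : (pPoly L γ m).coeff m = (-1) ^ m * leadAbs L γ m ∧
    (rPoly L γ (m + 1)).coeff m = γ m * L m * ((-1) ^ m * leadAbs L γ m) := by
  have step : ∀ m, (pPoly L γ m).coeff m = (-1) ^ m * leadAbs L γ m →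
      (rPoly L γ (m + 1)).coeff m = γ m * L m * ((-1) ^ m * leadAbs L γ m) := fun m hm => by
    simp [rPoly_succ, sPoly_succ, (coeff_eq_zero L γ m).2.1 m le_rfl,
      (coeff_eq_zero L γ m).2.2 m le_rfl, hm]
    ring
  have hp : (pPoly L γ m).coeff m = (-1) ^ m * leadAbs L γ m := by
    induction m with
    | zero => simp [pPoly_zero, leadAbs]
    | succ m ih =>
      have := step m ih
      rw [pPoly_succ, leadAbs, Finset.prod_range_succ, ← leadAbs]
      simp [this, (coeff_eq_zero L γ m).1 (m + 1) (by omega),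
        (coeff_eq_zero L γ m).2.1 m le_rfl]
      ring
  exact ⟨hp, step m hp⟩

theorem pPoly_coeff_zero (m : ℕ) : (pPoly L γ m).coeff 0 = 1 := by
  induction m with
  | zero => simp [pPoly_zero]
  | succ m ih => simp [pPoly_succ, ih]

theorem sPoly_coeff_zero (m : ℕ) : (sPoly L γ m).coeff 0 = ∑ i ∈ Finset.range m, L i := by
  induction m with
  | zero => simp [sPoly_zero]
  | succ m ih => simp [sPoly_succ, ih, pPoly_coeff_zero, Finset.sum_range_succ]

theorem rPoly_coeff_zero (m : ℕ) : (rPoly L γ m).coeff 0 =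
    ∑ i ∈ Finset.range m, γ i * ∑ k ∈ Finset.range (i + 1), L k := by
  induction m with
  | zero => simp [rPoly_zero]
  | succ m ih => rw [rPoly_succ, Finset.sum_range_succ, coeff_add, coeff_smul, ih,
      sPoly_coeff_zero, smul_eq_mul]

end Polys

/-- The values of a polynomial at the points `ζ_j`. -/
def evalAt {N : ℕ} (ζ : Fin N → ℝ) : ℝ[X] →ₗ[ℝ] (Fin N → ℝ) where
  toFun p j := p.eval (ζ j)
  map_add' p q := by ext; simp
  map_smul' c p := by ext; simp

theorem evalAt_mul {N : ℕ} (ζ : Fin N → ℝ) (p q : ℝ[X]) :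
    evalAt ζ (p * q) = evalAt ζ p * evalAt ζ q := by
  ext; simp [evalAt]

theorem evalAt_X {N : ℕ} (ζ : Fin N → ℝ) : evalAt ζ X = ζ := by
  ext; simp [evalAt]

theorem evalAt_one {N : ℕ} (ζ : Fin N → ℝ) : evalAt ζ 1 = 1 := by
  ext; simp [evalAt]

theorem evalAt_eq_sum {N : ℕ} (ζ : Fin N → ℝ) {p : ℝ[X]} {n : ℕ}
    (hp : ∀ i, n ≤ i → p.coeff i = 0) :
    evalAt ζ p = ∑ i ∈ Finset.range n, p.coeff i • ζ ^ i := by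
  ext j
  change p.eval (ζ j) = _
  have hd : p.degree < n := by
    rw [Polynomial.degree_lt_iff_coeff_zero]; exact hp
  by_cases h0 : p = 0
  · simp [h0]
  · rw [Polynomial.eval_eq_sum_range' ((Polynomial.natDegree_lt_iff_degree_lt h0).2 hd)]
    simp

namespace EigenData

variable {N : ℕ} {ζ b : Fin N → ℝ} {L γ : ℕ → ℝ} {G₁ G₂ G₃ : ℕ → Fin N → ℝ}

theorem eq_cauchy (h : EigenData ζ b L γ G₁ G₂ G₃) {m : ℕ} (hm : m ≤ N) :
    G₁ m = cauchy ζ b (evalAt ζ (pPoly L γ m)) ∧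
    G₂ m = 1 - ζ * cauchy ζ b (evalAt ζ (rPoly L γ m)) ∧
    G₃ m = ζ * cauchy ζ b (evalAt ζ (sPoly L γ m)) ∧
    mean b (evalAt ζ (rPoly L γ m)) = 1 - (-1) ^ m := by
  have hz : cauchy ζ b 0 = 0 := by ext; simp [cauchy]
  induction m using Nat.strong_induction_on with
  | _ m ih =>
  rcases m with _ | m
  · rw [rPoly_zero, sPoly_zero, pPoly_zero, evalAt_one, map_zero, hz, h.G₁_zero, h.G₂_zero,
      h.G₃_zero]
    simp [mean]
  obtain ⟨i1, i2, i3, i4⟩ := ih m (by omega) (by omega)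
  -- orthogonality of the previous polynomials to `G₂`
  have orthP : ∀ i ≤ m, ∀ n, i < n → n ≤ N → mean b (evalAt ζ (pPoly L γ i) * G₂ n) = 0 :=
    fun i hi n hin hn => h.mean_mul_G₂_eq_zero (ih i (by omega) (by omega)).1 hin hn
  have orthS : ∀ i ≤ m + 1, ∀ n, i ≤ n → n ≤ N →
      mean b (evalAt ζ (sPoly L γ i) * G₂ n) = 0 := by
    intro i
    induction i with
    | zero => intro _ n _ _; simp [sPoly_zero, mean]
    | succ i ihi =>
      intro hi n hin hn
      rw [sPoly_succ, map_add, map_smul, add_mul, mean_add, smul_mul_assoc, mean_smul,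
        ihi (by omega) n (by omega) hn, orthP i (by omega) n (by omega) hn]
      ring
  have orthR : ∀ i ≤ m + 1, ∀ n, i ≤ n → n ≤ N →
      mean b (evalAt ζ (rPoly L γ i) * G₂ n) = 0 := by
    intro i
    induction i with
    | zero => intro _ n _ _; simp [rPoly_zero, mean]
    | succ i ihi =>
      intro hi n hin hn
      rw [rPoly_succ, map_add, map_smul, add_mul, mean_add, smul_mul_assoc, mean_smul,
        ihi (by omega) n (by omega) hn, orthS (i + 1) (by omega) n hin hn]
      ring
  have e3 : G₃ (m + 1) = ζ * cauchy ζ b (evalAt ζ (sPoly L γ (m + 1))) := by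
    rw [h.G₃_succ m (by omega), i3, i1, sPoly_succ, map_add, map_smul, cauchy_add, cauchy_smul,
      mul_add, mul_smul_comm]
  have e2 : G₂ (m + 1) = 1 - ζ * cauchy ζ b (evalAt ζ (rPoly L γ (m + 1))) := by
    rw [h.G₂_succ m (by omega), i2, e3, rPoly_succ, map_add, map_smul, cauchy_add, cauchy_smul,
      mul_add, mul_smul_comm, sub_sub]
  -- the product of the two consecutive means
  have e4 : mean b (evalAt ζ (rPoly L γ (m + 1))) = 1 - (-1) ^ (m + 1) := by
    have hprod := mean_mul_mul_cauchy_add (b := b) h.ζ_pos (evalAt ζ (rPoly L γ m))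
      (evalAt ζ (rPoly L γ (m + 1)))
    have h1 := orthR m (by omega) (m + 1) (by omega) hm
    rw [e2, mul_sub, mean_sub, mul_one] at h1
    have h2 : mean b (evalAt ζ (rPoly L γ (m + 1)) * G₂ m) = 2 := by
      rw [rPoly_succ, sPoly_succ, map_add, map_smul, map_add, map_smul, add_mul, mean_add,
        smul_mul_assoc, mean_smul, add_mul, mean_add, smul_mul_assoc, mean_smul,
        orthR m (by omega) m le_rfl (by omega), orthS m (by omega) m le_rfl (by omega),
        ← h.mean_mul_G₂_self i1 (by omega)]
      ring
    rw [i2, mul_sub, mean_sub, mul_one] at h2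
    rw [i4] at h1 hprod
    have hsq : ((-1 : ℝ) ^ m) * (-1) ^ m = 1 := by rw [← mul_pow]; simp
    rw [pow_succ]
    linear_combination (-1) ^ m * (hprod + h1 + h2) -
      (mean b (evalAt ζ (rPoly L γ (m + 1))) - 1) * hsq
  refine ⟨?_, e2, e3, e4⟩
  have hc : ζ * cauchy ζ b (evalAt ζ (rPoly L γ m + rPoly L γ (m + 1))) =
      (2 : ℝ) • 1 - cauchy ζ b (ζ * evalAt ζ (rPoly L γ m + rPoly L γ (m + 1))) := by
    ext j
    have := mul_cauchy (b := b) h.ζ_pos (evalAt ζ (rPoly L γ m + rPoly L γ (m + 1))) j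
    simp only [Pi.mul_apply, Pi.sub_apply, Pi.smul_apply, Pi.one_apply, smul_eq_mul, mul_one]
    rw [this, map_add, mean_add, i4, e4, pow_succ]
    ring
  have hsum : G₂ m + G₂ (m + 1) =
      cauchy ζ b (ζ * evalAt ζ (rPoly L γ m + rPoly L γ (m + 1))) := by
    have : G₂ m + G₂ (m + 1) = (2 : ℝ) • 1 -
        ζ * cauchy ζ b (evalAt ζ (rPoly L γ m + rPoly L γ (m + 1))) := by
      rw [i2, e2, map_add, cauchy_add, mul_add, two_smul]; ring
    rw [this, hc]; ring
  rw [h.G₁_succ m (by omega), hsum, i1, pPoly_succ, map_sub, map_smul, evalAt_mul, evalAt_X,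
    sub_eq_add_neg (evalAt ζ (pPoly L γ m)), cauchy_add, ← neg_smul, cauchy_smul, neg_smul,
    sub_eq_add_neg]

theorem gram_pPoly (h : EigenData ζ b L γ G₁ G₂ G₃) {i m : ℕ} (hi : i ≤ N) (hm : m ≤ N) :
    mean b (evalAt ζ (pPoly L γ i) * cauchy ζ b (evalAt ζ (pPoly L γ m))) + 1 / 2 =
      if m = i then 1 / L i else 0 := by
  rw [← (h.eq_cauchy hm).1, h.mean_mul_G₁ hi (h.eq_cauchy hi).1 hm]; ring

theorem mean_G₁ (h : EigenData ζ b L γ G₁ G₂ G₃) {m : ℕ} (hm : m ≤ N) :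
    mean b (G₁ m) = (if m = 0 then 1 / L 0 else 0) - 1 / 2 := by
  rw [← h.mean_mul_G₁ (Nat.zero_le _) h.G₁_zero hm, one_mul]

theorem leadAbs_pos (h : EigenData ζ b L γ G₁ G₂ G₃) {m : ℕ} (hm : m ≤ N) :
    0 < leadAbs L γ m :=
  Finset.prod_pos fun i hi => by
    have hi := Finset.mem_range.1 hi
    have := h.L_pos i (by omega)
    have := h.γ_pos i (by omega)
    positivity

theorem mean_pow_mul_G₂ (h : EigenData ζ b L γ G₁ G₂ G₃) {k : ℕ} (hk : k ≤ N) {i : ℕ}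
    (hi : i < k) : mean b (ζ ^ i * G₂ k) = 0 := by
  induction i using Nat.strong_induction_on with
  | _ i ih =>
  have h0 := h.mean_mul_G₂_eq_zero (h.eq_cauchy (show i ≤ N by omega)).1 hi hk
  rw [evalAt_eq_sum ζ (n := i + 1) fun n hn => (coeff_eq_zero L γ i).1 n (by omega),
    Finset.sum_range_succ, add_mul, mean_add, smul_mul_assoc, mean_smul, Finset.sum_mul,
    mean_sum, Finset.sum_eq_zero, zero_add, (coeff_lead L γ i).1] at h0
  · have h1 : (-1 : ℝ) ^ i * leadAbs L γ i ≠ 0 :=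
      mul_ne_zero (pow_ne_zero _ (by norm_num)) (h.leadAbs_pos (by omega)).ne'
    exact (mul_eq_zero.1 h0).resolve_left h1
  · intro n hn
    have hn := Finset.mem_range.1 hn
    rw [smul_mul_assoc, mean_smul, ih n hn (by omega), mul_zero]

theorem G₃_eq_sum (h : EigenData ζ b L γ G₁ G₂ G₃) {m : ℕ} (hm : m ≤ N) :
    G₃ m = ζ * ∑ i ∈ Finset.range m, L i • G₁ i := by
  induction m with
  | zero => simp [h.G₃_zero]
  | succ m ih =>
    rw [h.G₃_succ m (by omega), ih (by omega), Finset.sum_range_succ, mul_add, mul_smul_comm]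

theorem mean_inv_mul_G₂_sub (h : EigenData ζ b L γ G₁ G₂ G₃) {k : ℕ} (hk : k < N) :
    mean b (ζ⁻¹ * G₂ k) - mean b (ζ⁻¹ * G₂ (k + 1)) =
      γ k * (1 - 1 / 2 * ∑ i ∈ Finset.range (k + 1), L i) := by
  have hinv : ζ⁻¹ * ζ = 1 := by
    ext j; simp [(h.ζ_pos j).ne']
  rw [h.G₂_succ k hk, mul_sub, mean_sub, mul_smul_comm, mean_smul, h.G₃_eq_sum (by omega),
    ← mul_assoc, hinv, one_mul, mean_sum]
  have : ∑ i ∈ Finset.range (k + 1), mean b (L i • G₁ i) =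
      1 - 1 / 2 * ∑ i ∈ Finset.range (k + 1), L i := by
    have e : ∀ i ∈ Finset.range (k + 1), mean b (L i • G₁ i) =
        (if i = 0 then 1 else 0) - 1 / 2 * L i := fun i hi => by
      have hi := Finset.mem_range.1 hi
      rw [mean_smul, h.mean_G₁ (by omega)]
      have := (h.L_pos 0 (by omega)).ne'
      split_ifs with h0
      · subst h0; field_simp
      · ring
    rw [Finset.sum_congr rfl e, Finset.sum_sub_distrib, Finset.sum_ite_eq',
      if_pos (Finset.mem_range.2 (by omega)), Finset.mul_sum]
  rw [this]; ring

end EigenData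

/-! ### Moments and bimoment determinants of the discrete measure -/

section Moments

variable {N : ℕ} {ζ b : Fin N → ℝ}

theorem integral_spectralMeasure (hb : ∀ j, 0 < b j) (f : ℝ → ℝ) :
    ∫ x, f x ∂(spectralMeasure ζ b) = mean b fun j => f (ζ j) := by
  rw [spectralMeasure, integral_finsetSum_measure]
  · simp [integral_smul_measure, mean, ENNReal.toReal_ofReal (hb _).le]
  · intro j _
    exact (integrable_dirac (by simp)).smul_measure ENNReal.ofReal_ne_top

theorem moment_spectralMeasure (hb : ∀ j, 0 < b j) (i : ℤ) :
    moment (spectralMeasure ζ b) i = mean b (ζ ^ i) := by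
  rw [moment, integral_spectralMeasure hb]; rfl

theorem bimoment_spectralMeasure (hb : ∀ j, 0 < b j) (i j : ℤ) :
    bimoment (spectralMeasure ζ b) i j = mean b (ζ ^ i * cauchy ζ b (ζ ^ j)) := by
  simp only [bimoment, integral_spectralMeasure hb, mean_mul_cauchy]
  simp only [mean, Finset.mul_sum]
  exact Finset.sum_congr rfl fun _ _ => Finset.sum_congr rfl fun _ _ => by
    simp only [Pi.pow_apply]; ring

theorem skewBimoment_spectralMeasure (hb : ∀ j, 0 < b j) (i j : ℤ) :
    skewBimoment (spectralMeasure ζ b) i j =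
      mean b (ζ ^ j * (ζ * cauchy ζ b (ζ ^ i))) - mean b (ζ ^ i * (ζ * cauchy ζ b (ζ ^ j))) := by
  simp only [skewBimoment, integral_spectralMeasure hb, ← mul_assoc]
  rw [mean_mul_cauchy, mean_mul_cauchy, Finset.sum_comm, ← Finset.sum_sub_distrib]
  simp only [mean, Finset.mul_sum]
  refine Finset.sum_congr rfl fun k _ => ?_
  rw [← Finset.sum_sub_distrib]
  refine Finset.sum_congr rfl fun l _ => ?_
  simp only [Pi.pow_apply, Pi.mul_apply]
  rw [add_comm (ζ l)]
  ring

theorem bimomentDet_natCast (μ : Measure ℝ) (k : ℕ) (i j : ℤ) :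
    bimomentDet μ k i j =
      Matrix.det (Matrix.of fun a b : Fin k => bimoment μ (i + (a : ℕ)) (j + (b : ℕ))) := by
  rw [bimomentDet, if_pos (Int.natCast_nonneg k)]
  rfl

/-- The determinant of the bimoment matrix with `c` added to its corner entry. -/
theorem det_bimoment_add_corner (μ : Measure ℝ) (k : ℕ) (c : ℝ) :
    Matrix.det (Matrix.of fun x y : Fin k => bimoment μ (x : ℕ) (y : ℕ) +
        if (x : ℕ) = 0 ∧ (y : ℕ) = 0 then c else 0) =
      bimomentDet μ k 0 0 + c * bimomentDet μ ((k : ℤ) - 1) 1 1 := by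
  rcases k with _ | n
  · rw [bimomentDet_natCast, bimomentDet, if_neg (by simp)]
    simp
  rw [show ((n + 1 : ℕ) : ℤ) - 1 = (n : ℕ) by simp, bimomentDet_natCast, bimomentDet_natCast]
  set B : Matrix (Fin (n + 1)) (Fin (n + 1)) ℝ :=
    Matrix.of fun x y => bimoment μ (0 + (x : ℕ)) (0 + (y : ℕ)) with hB
  have h1 : (Matrix.of fun x y : Fin (n + 1) => bimoment μ (x : ℕ) (y : ℕ) +
      if (x : ℕ) = 0 ∧ (y : ℕ) = 0 then c else 0) =
      B.updateRow 0 (B 0 + c • Pi.single 0 1) := by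
    ext x y
    by_cases hx : x = 0
    · subst hx
      rw [Matrix.updateRow_self]
      by_cases hy : y = 0
      · subst hy; simp [hB]
      · have : (y : ℕ) ≠ 0 := fun h => hy (Fin.ext h)
        simp [hB, hy]
    · rw [Matrix.updateRow_ne hx]
      have : (x : ℕ) ≠ 0 := fun h => hx (Fin.ext h)
      simp [hB, hx]
  rw [h1, Matrix.det_updateRow_add, Matrix.det_updateRow_smul, Matrix.updateRow_eq_self,
    ← Matrix.adjugate_apply, Matrix.adjugate_fin_succ_eq_det_submatrix]
  congr 2
  simp only [Fin.val_zero, add_zero, pow_zero, one_mul]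
  congr 1
  ext x y
  simp [hB, add_comm]

theorem det_diagonal_add_const {n : ℕ} {d : Fin n → ℝ} (hd : ∀ i, d i ≠ 0) (c : ℝ) :
    Matrix.det (Matrix.of fun i j => (if j = i then 1 / d i else 0) + c) =
      (∏ i, 1 / d i) * (1 + c * ∑ i, d i) := by
  have h : (Matrix.of fun i j => (if j = i then 1 / d i else 0) + c) =
      Matrix.diagonal (fun i => 1 / d i) *
        (1 + Matrix.replicateCol Unit (fun i => c * d i) *
          Matrix.replicateRow Unit (fun _ => (1 : ℝ))) := by
    ext i j
    rw [Matrix.diagonal_mul]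
    have := hd i
    by_cases hij : j = i
    · subst hij
      simp [Matrix.mul_apply]; field_simp
    · simp [Matrix.mul_apply, Matrix.one_apply_ne (Ne.symm hij), hij]; field_simp
  rw [h, Matrix.det_mul, Matrix.det_diagonal, Matrix.det_one_add_replicateCol_mul_replicateRow]
  congr 1
  simp [dotProduct, Finset.mul_sum]

end Moments

namespace EigenData

variable {N : ℕ} {ζ b : Fin N → ℝ} {L γ : ℕ → ℝ} {G₁ G₂ G₃ : ℕ → Fin N → ℝ}

theorem sq_mul_det_bimoment (h : EigenData ζ b L γ G₁ G₂ G₃) (hb : ∀ j, 0 < b j) {k : ℕ}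
    (hk : k ≤ N + 1) (c : ℝ) :
    (∏ m ∈ Finset.range k, leadAbs L γ m ^ 2) *
        (bimomentDet (spectralMeasure ζ b) k 0 0 +
          c * bimomentDet (spectralMeasure ζ b) ((k : ℤ) - 1) 1 1) =
      (∏ m ∈ Finset.range k, 1 / L m) * (1 + (c - 1 / 2) * ∑ m ∈ Finset.range k, L m) := by
  rw [← det_bimoment_add_corner]
  set A : Matrix (Fin k) (Fin k) ℝ := Matrix.of fun x y : Fin k =>
    bimoment (spectralMeasure ζ b) (x : ℕ) (y : ℕ) +
      if (x : ℕ) = 0 ∧ (y : ℕ) = 0 then c else 0 with hA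
  set T : Matrix (Fin k) (Fin k) ℝ := Matrix.of fun i x => (pPoly L γ i).coeff x with hT
  have hdetT : T.det ^ 2 = ∏ m ∈ Finset.range k, leadAbs L γ m ^ 2 := by
    rw [Matrix.det_of_isLowerTriangular T fun i j hij => (coeff_eq_zero L γ i).1 j hij,
      ← Finset.prod_pow, Finset.prod_range]
    refine Finset.prod_congr rfl fun i _ => ?_
    rw [hT, Matrix.of_apply, (coeff_lead L γ i).1, mul_pow, ← pow_mul, mul_comm (i : ℕ) 2,
      pow_mul]
    simp
  have hev : ∀ i : Fin k, evalAt ζ (pPoly L γ i) = ∑ x : Fin k, T i x • ζ ^ (x : ℕ) := by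
    intro i
    rw [evalAt_eq_sum ζ (n := k) fun n hn => (coeff_eq_zero L γ i).1 n (by omega),
      Finset.sum_range]
    rfl
  have hcau : ∀ (u : Fin k → ℝ), cauchy ζ b (∑ x : Fin k, u x • ζ ^ (x : ℕ)) =
      ∑ x : Fin k, u x • cauchy ζ b (ζ ^ (x : ℕ)) := by
    intro u
    ext j
    simp only [cauchy, Finset.sum_apply, Pi.smul_apply, smul_eq_mul, Finset.mul_sum,
      Finset.sum_div]
    rw [Finset.sum_comm]
    exact Finset.sum_congr rfl fun _ _ => Finset.sum_congr rfl fun _ _ => by ring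
  have hTAT : T * A * T.transpose =
      Matrix.of fun i j : Fin k => (if j = i then 1 / L i else 0) + (c - 1 / 2) := by
    ext i j
    have hg := h.gram_pPoly (i := i) (m := j) (by omega) (by omega)
    rw [hev, hev, hcau, Finset.sum_mul, mean_sum] at hg
    simp only [Finset.mul_sum, mean_sum, smul_mul_smul_comm, mean_smul] at hg
    have hbim : ∀ x y : Fin k, bimoment (spectralMeasure ζ b) (x : ℕ) (y : ℕ) =
        mean b (ζ ^ (x : ℕ) * cauchy ζ b (ζ ^ (y : ℕ))) := fun x y => by
      rw [bimoment_spectralMeasure hb, zpow_natCast, zpow_natCast]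
    have hi0 : T i ⟨0, i.pos⟩ = 1 := pPoly_coeff_zero L γ i
    have hj0 : T j ⟨0, i.pos⟩ = 1 := pPoly_coeff_zero L γ j
    have hcorner : ∑ x : Fin k, ∑ y : Fin k,
        T i x * T j y * (if (x : ℕ) = 0 ∧ (y : ℕ) = 0 then c else 0) = c := by
      rw [Finset.sum_eq_single ⟨0, i.pos⟩, Finset.sum_eq_single ⟨0, i.pos⟩]
      · simp [hi0, hj0]
      · intro y _ hy
        have : (y : ℕ) ≠ 0 := fun h => hy (Fin.ext h)
        simp [this]
      · simp
      · intro x _ hx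
        have : (x : ℕ) ≠ 0 := fun h => hx (Fin.ext h)
        simp [this]
      · simp
    have hexp : (T * A * T.transpose) i j = ∑ x : Fin k, ∑ y : Fin k, T i x * T j y * A x y := by
      simp only [Matrix.mul_apply, Matrix.transpose_apply, Finset.sum_mul]
      rw [Finset.sum_comm]
      exact Finset.sum_congr rfl fun _ _ => Finset.sum_congr rfl fun _ _ => by ring
    rw [hexp]
    simp only [hA, Matrix.of_apply, mul_add, Finset.sum_add_distrib, hcorner, hbim]
    have hval : ((j : ℕ) = (i : ℕ)) ↔ j = i := Fin.ext_iff.symm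
    simp only [hval] at hg
    linarith
  have hdet := congrArg Matrix.det hTAT
  rw [det_diagonal_add_const (fun i => (h.L_pos i (by omega)).ne'), Matrix.det_mul,
    Matrix.det_mul, Matrix.det_transpose] at hdet
  rw [← hdetT, Finset.prod_range, Finset.sum_range, ← hdet]
  ring

/-- The corrected bimoment determinant in terms of the string. -/
theorem det_eq_prod (h : EigenData ζ b L γ G₁ G₂ G₃) (hb : ∀ j, 0 < b j) {k : ℕ}
    (hk : k ≤ N + 1) :
    bimomentDet (spectralMeasure ζ b) k 0 0 +
        1 / 2 * bimomentDet (spectralMeasure ζ b) ((k : ℤ) - 1) 1 1 =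
      ∏ m ∈ Finset.range k, 1 / (L m * leadAbs L γ m ^ 2) := by
  have e := h.sq_mul_det_bimoment hb hk (1 / 2)
  have h0 : ∏ m ∈ Finset.range k, leadAbs L γ m ^ 2 ≠ 0 :=
    Finset.prod_ne_zero_iff.2 fun m hm =>
      (pow_pos (h.leadAbs_pos (by have := Finset.mem_range.1 hm; omega)) 2).ne'
  apply mul_left_cancel₀ h0
  rw [e, ← Finset.prod_mul_distrib, sub_self, zero_mul, add_zero, mul_one]
  refine Finset.prod_congr rfl fun m hm => ?_
  have := (h.leadAbs_pos (show m ≤ N by have := Finset.mem_range.1 hm; omega)).ne'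
  field_simp

theorem det_sub_eq (h : EigenData ζ b L γ G₁ G₂ G₃) (hb : ∀ j, 0 < b j) {k : ℕ}
    (hk : k ≤ N + 1) :
    bimomentDet (spectralMeasure ζ b) k 0 0 -
        1 / 2 * bimomentDet (spectralMeasure ζ b) ((k : ℤ) - 1) 1 1 =
      (1 - ∑ m ∈ Finset.range k, L m) * (bimomentDet (spectralMeasure ζ b) k 0 0 +
        1 / 2 * bimomentDet (spectralMeasure ζ b) ((k : ℤ) - 1) 1 1) := by
  have e1 := h.sq_mul_det_bimoment hb hk (1 / 2)
  have e2 := h.sq_mul_det_bimoment hb hk (-(1 / 2))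
  have h0 : ∏ m ∈ Finset.range k, leadAbs L γ m ^ 2 ≠ 0 :=
    Finset.prod_ne_zero_iff.2 fun m hm =>
      (pow_pos (h.leadAbs_pos (by have := Finset.mem_range.1 hm; omega)) 2).ne'
  apply mul_left_cancel₀ h0
  linear_combination e2 - (1 - ∑ m ∈ Finset.range k, L m) * e1

end EigenData

/-! ### Rules for Pfaffians of Gram matrices -/

section Rules

variable {E : Type*} [AddCommGroup E] [Module ℝ E] {ω : E →ₗ[ℝ] E →ₗ[ℝ] ℝ}

/-- The Pfaffian of a Gram matrix as a linear function of its first vector. -/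
def pfaffianFirst (ω : E →ₗ[ℝ] E →ₗ[ℝ] ℝ) {m : ℕ} (w : Fin (2 * m + 1) → E) : E →ₗ[ℝ] ℝ where
  toFun x := pfaffianAlternating ω (m + 1) (Fin.cons x w : Fin (2 * m + 2) → E)
  map_add' x y := by
    have h := map_add (AlternatingMap.curryLeft (n := 2 * m + 1) (pfaffianAlternating ω (m + 1))) x y
    exact DFunLike.congr_fun h w
  map_smul' c x := by
    have h := map_smul (AlternatingMap.curryLeft (n := 2 * m + 1) (pfaffianAlternating ω (m + 1))) c x
    exact DFunLike.congr_fun h w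

theorem pfaffianFirst_apply (ω : E →ₗ[ℝ] E →ₗ[ℝ] ℝ) {m : ℕ} (x : E)
    (w : Fin (2 * m + 1) → E) : pfaffianFirst ω w x =
      pfaffianAlternating ω (m + 1) (Fin.cons x w : Fin (2 * m + 2) → E) := rfl

theorem pfaffianFirst_self (ω : E →ₗ[ℝ] E →ₗ[ℝ] ℝ) {m : ℕ} (w : Fin (2 * m + 1) → E)
    (j : Fin (2 * m + 1)) : pfaffianFirst ω w (w j) = 0 :=
  AlternatingMap.map_eq_zero_of_eq (pfaffianAlternating ω (m + 1))
    (Fin.cons (w j) w : Fin (2 * m + 2) → E) (i := (0 : Fin (2 * m + 2))) (j := j.succ) rfl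
    (Fin.succ_ne_zero j).symm

theorem pfaffianAlternating_cons_cons (hω : ∀ x y, ω x y = -ω y x) {m : ℕ} {x y : E}
    {w : Fin (2 * m) → E} (hx : ∀ i, ω x (w i) = 0) :
    pfaffianAlternating ω (m + 1) (Fin.cons x (Fin.cons y w : Fin (2 * m + 1) → E) :
      Fin (2 * m + 2) → E) = ω x y * pfaffianAlternating ω m w := by
  rw [pfaffianAlternating_apply hω, pfaffianAlternating_apply hω]
  exact pfaffian_eq_mul_of_row_zero _ hx

theorem pfaffianAlternating_cons_eq_zero (hω : ∀ x y, ω x y = -ω y x) {m : ℕ} {x : E}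
    {w : Fin (2 * m + 1) → E} (hx : ∀ i, ω x (w i) = 0) :
    pfaffianAlternating ω (m + 1) (Fin.cons x w : Fin (2 * m + 2) → E) = 0 := by
  rw [← Fin.cons_self_tail w, pfaffianAlternating_cons_cons hω (w := Fin.tail w) fun i => hx i.succ, hx, zero_mul]

theorem pfaffianFirst_sum (ω : E →ₗ[ℝ] E →ₗ[ℝ] ℝ) {m : ℕ} {ι : Type*}
    {t : Finset ι} {c : ι → ℝ} {e : ι → E} {w : Fin (2 * m + 1) → E} {i₀ : ι} (hi₀ : i₀ ∈ t)
    (hw : ∀ i ∈ t, i ≠ i₀ → ∃ j, w j = e i) :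
    pfaffianFirst ω w (∑ i ∈ t, c i • e i) = c i₀ * pfaffianFirst ω w (e i₀) := by
  simp only [map_sum, map_smul, smul_eq_mul]
  refine Finset.sum_eq_single_of_mem i₀ hi₀ fun i hi hne => ?_
  obtain ⟨j, hj⟩ := hw i hi hne
  rw [← hj, pfaffianFirst_self, mul_zero]

theorem pfaffianFirst_sum_eq_zero (ω : E →ₗ[ℝ] E →ₗ[ℝ] ℝ) {m : ℕ} {ι : Type*}
    {t : Finset ι} {c : ι → ℝ} {e : ι → E} {w : Fin (2 * m + 1) → E}
    (hw : ∀ i ∈ t, ∃ j, w j = e i) : pfaffianFirst ω w (∑ i ∈ t, c i • e i) = 0 := by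
  simp only [map_sum, map_smul, smul_eq_mul]
  refine Finset.sum_eq_zero fun i hi => ?_
  obtain ⟨j, hj⟩ := hw i hi
  rw [← hj, pfaffianFirst_self, mul_zero]

theorem pfaffianAlternating_snoc (ω : E →ₗ[ℝ] E →ₗ[ℝ] ℝ) {m : ℕ} (x : E)
    (w : Fin (2 * m + 1) → E) :
    pfaffianAlternating ω (m + 1) (Fin.snoc w x : Fin (2 * m + 2) → E) =
      -pfaffianAlternating ω (m + 1) (Fin.cons x w : Fin (2 * m + 2) → E) := by
  rw [Fin.snoc_eq_cons_rotate]
  have := (pfaffianAlternating ω (m + 1)).map_perm (Fin.cons x w : Fin (2 * m + 2) → E)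
    (finRotate (2 * m + 2))
  have hs : Equiv.Perm.sign (α := Fin (2 * (m + 1))) (finRotate (2 * m + 2)) = -1 := by
    refine (sign_finRotate (2 * m + 2)).trans ?_
    rw [show 2 * m + 2 - 1 = 2 * m + 1 from rfl, pow_succ, pow_mul]
    simp
  rw [hs] at this
  refine Eq.trans ?_ (this.trans (by simp))
  rfl

theorem pfaffianAlternating_swap (ω : E →ₗ[ℝ] E →ₗ[ℝ] ℝ) {m : ℕ} (x y : E)
    (w : Fin (2 * m) → E) :
    pfaffianAlternating ω (m + 1) (Fin.cons x (Fin.cons y w : Fin (2 * m + 1) → E) :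
      Fin (2 * m + 2) → E) = -pfaffianAlternating ω (m + 1)
        (Fin.cons y (Fin.cons x w : Fin (2 * m + 1) → E) : Fin (2 * m + 2) → E) := by
  have h := (pfaffianAlternating ω (m + 1)).map_swap
    (Fin.cons y (Fin.cons x w : Fin (2 * m + 1) → E) : Fin (2 * m + 2) → E)
    (i := (0 : Fin (2 * m + 2))) (j := (1 : Fin (2 * m + 2))) (by simp)
  rw [← h]
  congr 1
  ext i
  refine Fin.cases ?_ (fun i => ?_) i
  · rw [Function.comp_apply, Equiv.swap_apply_left]; rfl
  · refine Fin.cases ?_ (fun i => ?_) i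
    · rw [Function.comp_apply, Fin.succ_zero_eq_one, Equiv.swap_apply_right]; rfl
    · rw [Function.comp_apply, Equiv.swap_apply_of_ne_of_ne (Fin.succ_ne_zero _)
        (by rw [← Fin.succ_zero_eq_one]; exact fun h => Fin.succ_ne_zero _ (Fin.succ_injective _ h))]
      simp

end Rules

/-! ### The skew form behind the Pfaffians `τ` -/

section Skew

variable {N : ℕ} (ζ b : Fin N → ℝ)

/-- The skew form on functions on the spectrum given by the kernel `(y - x) / (x + y)`, extended
by a vector that pairs with a function to its integral. -/
def skewForm : ℝ × (Fin N → ℝ) →ₗ[ℝ] ℝ × (Fin N → ℝ) →ₗ[ℝ] ℝ :=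
  LinearMap.mk₂ ℝ (fun x y => x.1 * mean b y.2 - y.1 * mean b x.2 +
    (mean b (y.2 * (ζ * cauchy ζ b x.2)) - mean b (x.2 * (ζ * cauchy ζ b y.2))))
    (fun x x' y => by
      simp only [Prod.fst_add, Prod.snd_add, mean_add, cauchy_add, mul_add, add_mul]; ring)
    (fun c x y => by
      simp only [Prod.smul_fst, Prod.smul_snd, mean_smul, cauchy_smul, mul_smul_comm,
        smul_mul_assoc, smul_eq_mul]; ring)
    (fun x y y' => by
      simp only [Prod.fst_add, Prod.snd_add, mean_add, cauchy_add, mul_add, add_mul]; ring)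
    (fun c x y => by
      simp only [Prod.smul_fst, Prod.smul_snd, mean_smul, cauchy_smul, mul_smul_comm,
        smul_mul_assoc, smul_eq_mul]; ring)

theorem skewForm_apply (x y : ℝ × (Fin N → ℝ)) : skewForm ζ b x y =
    x.1 * mean b y.2 - y.1 * mean b x.2 +
      (mean b (y.2 * (ζ * cauchy ζ b x.2)) - mean b (x.2 * (ζ * cauchy ζ b y.2))) := rfl

theorem skewForm_neg (x y : ℝ × (Fin N → ℝ)) : skewForm ζ b x y = -skewForm ζ b y x := by
  simp only [skewForm_apply]; ring

/-- The vector that represents integration. -/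
def integralVec : ℝ × (Fin N → ℝ) := (1, 0)

/-- The vector of the function `x ↦ x ^ i`. -/
def powVec (i : ℤ) : ℝ × (Fin N → ℝ) := (0, ζ ^ i)

variable {ζ b}

theorem skewForm_powVec (hb : ∀ j, 0 < b j) (i j : ℤ) :
    skewForm ζ b (powVec ζ i) (powVec ζ j) = skewBimoment (spectralMeasure ζ b) i j := by
  rw [skewBimoment_spectralMeasure hb, skewForm_apply]
  simp [powVec]

theorem skewForm_integralVec (u : Fin N → ℝ) : skewForm ζ b integralVec (0, u) = mean b u := by
  simp [skewForm_apply, integralVec, mean, cauchy]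

theorem skewForm_integralVec_self : skewForm ζ b integralVec integralVec = 0 := by
  simp [skewForm_apply, integralVec, mean]

theorem tau_even (hb : ∀ j, 0 < b j) (m : ℕ) (l : ℤ) :
    tau (spectralMeasure ζ b) ((2 * m : ℕ) : ℤ) l =
      pfaffianAlternating (skewForm ζ b) m fun i => powVec ζ (l + (i : ℕ)) := by
  have h : ((2 * m : ℕ) : ℤ).toNat / 2 = m := by
    rw [Int.toNat_natCast]; omega
  rw [tau, if_neg (by omega), if_pos (by simp), h, pfaffianAlternating_apply (skewForm_neg ζ b)]
  congr 1
  ext i j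
  simp [skewMatrix, skewForm_powVec hb]

theorem tau_odd (hb : ∀ j, 0 < b j) (m : ℕ) (l : ℤ) :
    tau (spectralMeasure ζ b) ((2 * m + 1 : ℕ) : ℤ) l =
      pfaffianAlternating (skewForm ζ b) (m + 1)
        (Fin.cons integralVec fun i : Fin (2 * m + 1) => powVec ζ (l + (i : ℕ)) :
          Fin (2 * m + 2) → ℝ × (Fin N → ℝ)) := by
  have h : ((2 * m + 1 : ℕ) : ℤ).toNat / 2 = m := by
    rw [Int.toNat_natCast]; omega
  rw [tau, if_neg (by omega), if_neg (by
    rw [Int.not_even_iff_odd]; exact ⟨m, by push_cast; ring⟩), h,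
    pfaffianAlternating_apply (skewForm_neg ζ b)]
  congr 1
  ext i j
  change borderedMatrix _ l (2 * m + 2) i j = _
  have hs : ∀ k : ℤ, skewForm ζ b integralVec (powVec ζ k) = moment (spectralMeasure ζ b) k := fun k => by
    rw [moment_spectralMeasure hb, powVec, skewForm_integralVec]
  have hidx : ∀ k : ℕ, l + ((k + 1 : ℕ) : ℤ) - 1 = l + k := fun k => by push_cast; ring
  revert i j
  intro (i : Fin (2 * m + 2)) (j : Fin (2 * m + 2))
  refine Fin.cases ?_ (fun i => ?_) i <;> refine Fin.cases ?_ (fun j => ?_) j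
  · simp [borderedMatrix, skewForm_integralVec_self]
  · simp only [borderedMatrix, Matrix.of_apply, Fin.cons_zero, Fin.cons_succ, Fin.val_succ, hidx]
    simp [hs]
  · simp only [borderedMatrix, Matrix.of_apply, Fin.cons_zero, Fin.cons_succ, Fin.val_succ, hidx]
    rw [skewForm_neg]
    simp [hs]
  · simp only [borderedMatrix, Matrix.of_apply, Fin.cons_succ, Fin.val_succ, hidx]
    simp [skewForm_powVec hb]

end Skew

namespace EigenData

variable {N : ℕ} {ζ b : Fin N → ℝ} {L γ : ℕ → ℝ} {G₁ G₂ G₃ : ℕ → Fin N → ℝ}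

theorem neg_one_pow_two_mul (m : ℕ) : (-1 : ℝ) ^ (2 * m) = 1 := by simp [pow_mul]

theorem neg_one_pow_two_mul_add_one (m : ℕ) : (-1 : ℝ) ^ (2 * m + 1) = -1 := by
  rw [pow_succ, neg_one_pow_two_mul, one_mul]

/-! ### The functions `r_k / 2` in the skew form -/

variable (ζ L γ) in
/-- The vector of the function `r_k / 2`. -/
def rVec (k : ℕ) : ℝ × (Fin N → ℝ) := (0, (1 / 2 : ℝ) • evalAt ζ (rPoly L γ k))

theorem rVec_eq_sum (k : ℕ) : rVec ζ L γ k =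
    ∑ i ∈ Finset.range k, ((rPoly L γ k).coeff i / 2) • powVec ζ (i : ℤ) := by
  rw [rVec, evalAt_eq_sum ζ (coeff_eq_zero L γ k).2.1, Finset.smul_sum]
  refine Prod.ext ?_ ?_
  · simp [Prod.fst_sum, powVec]
  · simp only [Prod.snd_sum]
    refine Finset.sum_congr rfl fun i _ => ?_
    rw [smul_smul, powVec, Prod.smul_snd, zpow_natCast]
    congr 1; ring

theorem skewForm_integralVec_rVec (h : EigenData ζ b L γ G₁ G₂ G₃) {k : ℕ} (hk : k ≤ N) :
    skewForm ζ b integralVec (rVec ζ L γ k) = (1 - (-1) ^ k) / 2 := by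
  rw [rVec, skewForm_integralVec, mean_smul, (h.eq_cauchy hk).2.2.2]; ring

theorem skewForm_rVec_powVec (h : EigenData ζ b L γ G₁ G₂ G₃) {k : ℕ} (hk : k ≤ N) (i : ℤ) :
    skewForm ζ b (rVec ζ L γ k) (powVec ζ i) =
      (1 + (-1) ^ k) / 2 * mean b (ζ ^ i) - mean b (ζ ^ i * G₂ k) := by
  have h1 := mean_mul_mul_cauchy_add (b := b) h.ζ_pos (evalAt ζ (rPoly L γ k)) (ζ ^ i)
  obtain ⟨-, h2, -, h4⟩ := h.eq_cauchy hk
  rw [skewForm_apply, h2, mul_sub, mean_sub, mul_one]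
  simp only [rVec, powVec, cauchy_smul, mul_smul_comm, smul_mul_assoc, mean_smul, zero_mul,
    sub_zero]
  rw [h4] at h1
  linear_combination (-1 / 2 : ℝ) * h1

theorem skewForm_rVec_powVec_of_lt (h : EigenData ζ b L γ G₁ G₂ G₃) {k : ℕ} (hk : k ≤ N) {i : ℕ}
    (hi : i < k) : skewForm ζ b (rVec ζ L γ k) (powVec ζ i) =
      (1 + (-1) ^ k) / 2 * skewForm ζ b integralVec (powVec ζ i) := by
  rw [h.skewForm_rVec_powVec hk, zpow_natCast, h.mean_pow_mul_G₂ hk hi, powVec, skewForm_integralVec,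
    zpow_natCast, sub_zero]

theorem skewForm_rVec_inv (h : EigenData ζ b L γ G₁ G₂ G₃) {k : ℕ} (hk : k ≤ N) :
    skewForm ζ b (rVec ζ L γ k) (powVec ζ (-1)) =
      (1 + (-1) ^ k) / 2 * skewForm ζ b integralVec (powVec ζ (-1)) - mean b (ζ⁻¹ * G₂ k) := by
  rw [h.skewForm_rVec_powVec hk, powVec, skewForm_integralVec, zpow_neg_one]

theorem skewForm_integralVec_rVec_odd (h : EigenData ζ b L γ G₁ G₂ G₃) {m : ℕ} (hm : 2 * m < N) :
    skewForm ζ b (rVec ζ L γ (2 * m + 1)) integralVec = -1 := by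
  rw [skewForm_neg, h.skewForm_integralVec_rVec hm, neg_one_pow_two_mul_add_one]; norm_num

theorem skewForm_rVec_odd (h : EigenData ζ b L γ G₁ G₂ G₃) {m : ℕ} (hm : 2 * m < N) {i : ℕ}
    (hi : i < 2 * m + 1) : skewForm ζ b (rVec ζ L γ (2 * m + 1)) (powVec ζ i) = 0 := by
  rw [h.skewForm_rVec_powVec_of_lt hm hi, neg_one_pow_two_mul_add_one]; simp

theorem skewForm_rVec_odd_inv (h : EigenData ζ b L γ G₁ G₂ G₃) {m : ℕ} (hm : 2 * m < N) :
    skewForm ζ b (rVec ζ L γ (2 * m + 1)) (powVec ζ (-1)) =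
      -mean b (ζ⁻¹ * G₂ (2 * m + 1)) := by
  rw [h.skewForm_rVec_inv hm, neg_one_pow_two_mul_add_one]; simp

/-- For even `k`, the vector `integralVec - r_k / 2` is orthogonal to low powers. -/
theorem skewForm_integralVec_sub (h : EigenData ζ b L γ G₁ G₂ G₃) {m : ℕ} (hm : 2 * m ≤ N) {i : ℕ}
    (hi : i < 2 * m) : skewForm ζ b (integralVec - rVec ζ L γ (2 * m)) (powVec ζ i) = 0 := by
  rw [map_sub, LinearMap.sub_apply, h.skewForm_rVec_powVec_of_lt hm hi, neg_one_pow_two_mul]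
  ring

theorem skewForm_integralVec_sub_inv (h : EigenData ζ b L γ G₁ G₂ G₃) {m : ℕ} (hm : 2 * m ≤ N) :
    skewForm ζ b (integralVec - rVec ζ L γ (2 * m)) (powVec ζ (-1)) = mean b (ζ⁻¹ * G₂ (2 * m)) := by
  rw [map_sub, LinearMap.sub_apply, h.skewForm_rVec_inv hm, neg_one_pow_two_mul]
  ring

/-! ### Relations between the Pfaffians -/

/-- The ratio of two consecutive Pfaffians `τ`. -/
def tauRatio (L γ : ℕ → ℝ) (n : ℕ) : ℝ := γ n * L n * leadAbs L γ n / 2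

theorem tauRatio_pos (h : EigenData ζ b L γ G₁ G₂ G₃) {n : ℕ} (hn : n < N) :
    0 < tauRatio L γ n := by
  have h1 := h.γ_pos _ hn
  have h2 := h.L_pos _ hn.le
  have h3 := h.leadAbs_pos hn.le
  unfold tauRatio
  positivity

/-- The leading coefficient of `r_{n+1} / 2`. -/
theorem coeff_rPoly_half (n : ℕ) : (rPoly L γ (n + 1)).coeff n / 2 =
    (-1) ^ n * tauRatio L γ n := by
  rw [(coeff_lead L γ n).2, tauRatio]; ring

theorem tau_odd_step (h : EigenData ζ b L γ G₁ G₂ G₃) (hb : ∀ j, 0 < b j) {m : ℕ}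
    (hm : 2 * m < N) :
    tau (spectralMeasure ζ b) ((2 * m : ℕ) : ℤ) 0 =
      tauRatio L γ (2 * m) * tau (spectralMeasure ζ b) ((2 * m + 1 : ℕ) : ℤ) 0 := by
  obtain ⟨w, hw⟩ : ∃ w : Fin (2 * m) → ℝ × (Fin N → ℝ),
    w = fun i : Fin (2 * m) => powVec ζ (0 + (i : ℕ)) := ⟨_, rfl⟩
  have hw' : ∀ i : Fin (2 * m), w i = powVec ζ ((i : ℕ) : ℤ) := fun i => by
    simp only [hw, zero_add]
  have e1 := pfaffianAlternating_cons_cons (skewForm_neg ζ b) (y := integralVec) (w := w)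
    (x := rVec ζ L γ (2 * m + 1)) fun i => by
      rw [hw']; exact h.skewForm_rVec_odd hm (by omega)
  rw [h.skewForm_integralVec_rVec_odd hm, ← pfaffianFirst_apply, rVec_eq_sum,
    pfaffianFirst_sum _ (i₀ := 2 * m) (by simp), coeff_rPoly_half, pfaffianFirst_apply,
    neg_one_pow_two_mul] at e1
  · have e2 := pfaffianAlternating_snoc (skewForm ζ b) (powVec ζ ((2 * m : ℕ) : ℤ))
      (Fin.cons integralVec w : Fin (2 * m + 1) → _)
    have e3 : (Fin.snoc (Fin.cons integralVec w : Fin (2 * m + 1) → _) (powVec ζ ((2 * m : ℕ) : ℤ)) :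
        Fin (2 * m + 2) → ℝ × (Fin N → ℝ)) =
        (Fin.cons integralVec fun i : Fin (2 * m + 1) => powVec ζ (0 + (i : ℕ)) :
          Fin (2 * m + 2) → ℝ × (Fin N → ℝ)) := by
      rw [← Fin.cons_snoc_eq_snoc_cons]
      congr 1
      ext1 i
      refine Fin.lastCases ?_ (fun i => ?_) i <;> simp [hw]
    rw [e3] at e2
    rw [tau_even hb, tau_odd hb, e2, ← hw]
    linarith
  · intro i hi hne
    have hi : i < 2 * m + 1 := Finset.mem_range.1 hi
    exact ⟨Fin.succ ⟨i, by omega⟩, by rw [Fin.cons_succ, hw']⟩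

theorem tau_odd_shift (h : EigenData ζ b L γ G₁ G₂ G₃) (hb : ∀ j, 0 < b j) {m : ℕ}
    (hm : 2 * m < N) :
    tau (spectralMeasure ζ b) ((2 * m : ℕ) : ℤ) 1 = (rPoly L γ (2 * m + 1)).coeff 0 / 2 *
      tau (spectralMeasure ζ b) ((2 * m + 1 : ℕ) : ℤ) 0 := by
  obtain ⟨w, hw⟩ : ∃ w : Fin (2 * m) → ℝ × (Fin N → ℝ),
    w = fun i : Fin (2 * m) => powVec ζ (1 + (i : ℕ)) := ⟨_, rfl⟩
  have hw' : ∀ i : Fin (2 * m), w i = powVec ζ ((i + 1 : ℕ) : ℤ) := fun i => by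
    simp only [hw]; congr 1; push_cast; ring
  have e1 := pfaffianAlternating_cons_cons (skewForm_neg ζ b) (y := integralVec) (w := w)
    (x := rVec ζ L γ (2 * m + 1)) fun i => by
      rw [hw']; exact h.skewForm_rVec_odd hm (by omega)
  rw [h.skewForm_integralVec_rVec_odd hm, ← pfaffianFirst_apply, rVec_eq_sum,
    pfaffianFirst_sum _ (i₀ := 0) (by simp), pfaffianFirst_apply, pfaffianAlternating_swap] at e1
  · have e3 : (Fin.cons (powVec ζ ((0 : ℕ) : ℤ)) w : Fin (2 * m + 1) → _) =
        fun i : Fin (2 * m + 1) => powVec ζ (0 + (i : ℕ)) := by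
      ext1 i
      refine Fin.cases ?_ (fun i => ?_) i
      · simp
      · rw [Fin.cons_succ, hw']; simp
    rw [e3] at e1
    rw [tau_even hb, tau_odd hb, ← hw]
    linarith
  · intro i hi hne
    have hi : i < 2 * m + 1 := Finset.mem_range.1 hi
    refine ⟨Fin.succ ⟨i - 1, by omega⟩, ?_⟩
    rw [Fin.cons_succ, hw']
    congr 2
    simp only
    omega

theorem tau_odd_inv (h : EigenData ζ b L γ G₁ G₂ G₃) (hb : ∀ j, 0 < b j) {m : ℕ}
    (hm : 2 * m < N) :
    tau (spectralMeasure ζ b) ((2 * m + 2 : ℕ) : ℤ) (-1) = mean b (ζ⁻¹ * G₂ (2 * m + 1)) *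
      tau (spectralMeasure ζ b) ((2 * m + 1 : ℕ) : ℤ) 0 := by
  obtain ⟨w, hw⟩ : ∃ w : Fin (2 * m) → ℝ × (Fin N → ℝ),
    w = fun i : Fin (2 * m) => powVec ζ (0 + (i : ℕ)) := ⟨_, rfl⟩
  have hw' : ∀ i : Fin (2 * m), w i = powVec ζ ((i : ℕ) : ℤ) := fun i => by
    simp only [hw, zero_add]
  have e1 := pfaffianAlternating_cons_cons (skewForm_neg ζ b) (y := powVec ζ (-1)) (w := w)
    (x := rVec ζ L γ (2 * m + 1)) fun i => by
      rw [hw']; exact h.skewForm_rVec_odd hm (by omega)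
  rw [h.skewForm_rVec_odd_inv hm, ← pfaffianFirst_apply, rVec_eq_sum,
    pfaffianFirst_sum _ (i₀ := 2 * m) (by simp), coeff_rPoly_half, pfaffianFirst_apply,
    neg_one_pow_two_mul] at e1
  · have e2 := pfaffianAlternating_snoc (skewForm ζ b) (powVec ζ ((2 * m : ℕ) : ℤ))
      (Fin.cons (powVec ζ (-1)) w : Fin (2 * m + 1) → _)
    have e3 : (Fin.snoc (Fin.cons (powVec ζ (-1)) w : Fin (2 * m + 1) → _)
        (powVec ζ ((2 * m : ℕ) : ℤ)) : Fin (2 * m + 2) → ℝ × (Fin N → ℝ)) =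
        fun i : Fin (2 * m + 2) => powVec ζ (-1 + (i : ℕ)) := by
      ext1 i
      refine Fin.cases ?_ (fun i => ?_) i
      · rw [← Fin.cons_snoc_eq_snoc_cons]; simp
      · rw [← Fin.cons_snoc_eq_snoc_cons, Fin.cons_succ]
        refine Fin.lastCases ?_ (fun i => ?_) i <;> simp [hw]
    rw [e3] at e2
    have e4 := h.tau_odd_step hb hm
    rw [tau_even hb, ← hw] at e4
    apply mul_left_cancel₀ (h.tauRatio_pos hm).ne'
    rw [e4] at e1
    refine (congrArg _ ((tau_even hb (m + 1) (-1)).trans e2)).trans ?_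
    linear_combination -e1
  · intro i hi hne
    have hi : i < 2 * m + 1 := Finset.mem_range.1 hi
    exact ⟨Fin.succ ⟨i, by omega⟩, by rw [Fin.cons_succ, hw']⟩

theorem tau_even_step (h : EigenData ζ b L γ G₁ G₂ G₃) (hb : ∀ j, 0 < b j) {m : ℕ}
    (hm : 2 * m + 1 < N) :
    tau (spectralMeasure ζ b) ((2 * m + 1 : ℕ) : ℤ) 0 =
      tauRatio L γ (2 * m + 1) * tau (spectralMeasure ζ b) ((2 * m + 2 : ℕ) : ℤ) 0 := by
  obtain ⟨w, hw⟩ : ∃ w : Fin (2 * m + 1) → ℝ × (Fin N → ℝ),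
    w = fun i : Fin (2 * m + 1) => powVec ζ (0 + (i : ℕ)) := ⟨_, rfl⟩
  have hw' : ∀ i : Fin (2 * m + 1), w i = powVec ζ ((i : ℕ) : ℤ) := fun i => by
    simp only [hw, zero_add]
  have e1 : pfaffianFirst (skewForm ζ b) w (integralVec - rVec ζ L γ (2 * m + 1 + 1)) = 0 :=
    pfaffianAlternating_cons_eq_zero (skewForm_neg ζ b) fun i => by
      rw [hw']
      exact h.skewForm_integralVec_sub (m := m + 1) (by omega) (by omega)
  rw [map_sub, rVec_eq_sum, pfaffianFirst_sum _ (i₀ := 2 * m + 1) (by simp),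
    coeff_rPoly_half, pfaffianFirst_apply, pfaffianFirst_apply,
    neg_one_pow_two_mul_add_one] at e1
  · have e2 := pfaffianAlternating_snoc (skewForm ζ b) (powVec ζ ((2 * m + 1 : ℕ) : ℤ)) w
    have e3 : (Fin.snoc w (powVec ζ ((2 * m + 1 : ℕ) : ℤ)) : Fin (2 * m + 2) → _) =
        fun i : Fin (2 * m + 2) => powVec ζ (0 + (i : ℕ)) := by
      ext1 i
      refine Fin.lastCases ?_ (fun i => ?_) i <;> simp [hw]
    rw [e3] at e2
    rw [tau_odd hb, ← hw]
    refine Eq.trans ?_ (congrArg _ ((tau_even hb (m + 1) 0).trans e2)).symm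
    linear_combination e1
  · intro i hi hne
    have hi : i < 2 * m + 1 + 1 := Finset.mem_range.1 hi
    exact ⟨⟨i, by omega⟩, by rw [hw']⟩

theorem tau_even_shift (h : EigenData ζ b L γ G₁ G₂ G₃) (hb : ∀ j, 0 < b j) {m : ℕ}
    (hm : 2 * m + 1 < N) :
    tau (spectralMeasure ζ b) ((2 * m + 1 : ℕ) : ℤ) 1 = (rPoly L γ (2 * m + 2)).coeff 0 / 2 *
      tau (spectralMeasure ζ b) ((2 * m + 2 : ℕ) : ℤ) 0 := by
  obtain ⟨w, hw⟩ : ∃ w : Fin (2 * m + 1) → ℝ × (Fin N → ℝ),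
    w = fun i : Fin (2 * m + 1) => powVec ζ (1 + (i : ℕ)) := ⟨_, rfl⟩
  have hw' : ∀ i : Fin (2 * m + 1), w i = powVec ζ ((i + 1 : ℕ) : ℤ) := fun i => by
    simp only [hw]; congr 1; push_cast; ring
  have e1 : pfaffianFirst (skewForm ζ b) w (integralVec - rVec ζ L γ (2 * m + 2)) = 0 :=
    pfaffianAlternating_cons_eq_zero (skewForm_neg ζ b) fun i => by
      rw [hw']
      exact h.skewForm_integralVec_sub (m := m + 1) (by omega) (by omega)
  rw [map_sub, rVec_eq_sum, pfaffianFirst_sum _ (i₀ := 0) (by simp),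
    pfaffianFirst_apply, pfaffianFirst_apply] at e1
  · have e3 : (Fin.cons (powVec ζ ((0 : ℕ) : ℤ)) w : Fin (2 * m + 2) → _) =
        fun i : Fin (2 * m + 2) => powVec ζ (0 + (i : ℕ)) := by
      ext1 i
      refine Fin.cases ?_ (fun i => ?_) i
      · simp
      · rw [Fin.cons_succ, hw']; simp
    rw [e3] at e1
    rw [tau_odd hb, ← hw]
    exact (sub_eq_zero.1 e1).trans (congrArg _ (tau_even hb (m + 1) 0)).symm
  · intro i hi hne
    have hi : i < 2 * m + 2 := Finset.mem_range.1 hi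
    refine ⟨⟨i - 1, by omega⟩, ?_⟩
    rw [hw']
    congr 2
    simp only
    omega

theorem tau_even_inv (h : EigenData ζ b L γ G₁ G₂ G₃) (hb : ∀ j, 0 < b j) {m : ℕ}
    (hm : 2 * m ≤ N) :
    tau (spectralMeasure ζ b) ((2 * m + 1 : ℕ) : ℤ) (-1) = mean b (ζ⁻¹ * G₂ (2 * m)) *
      tau (spectralMeasure ζ b) ((2 * m : ℕ) : ℤ) 0 := by
  obtain ⟨w, hw⟩ : ∃ w : Fin (2 * m) → ℝ × (Fin N → ℝ),
    w = fun i : Fin (2 * m) => powVec ζ (0 + (i : ℕ)) := ⟨_, rfl⟩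
  have hw' : ∀ i : Fin (2 * m), w i = powVec ζ ((i : ℕ) : ℤ) := fun i => by
    simp only [hw, zero_add]
  have e1 : pfaffianFirst (skewForm ζ b) (Fin.cons (powVec ζ (-1)) w : Fin (2 * m + 1) → _)
      (integralVec - rVec ζ L γ (2 * m)) = _ :=
    pfaffianAlternating_cons_cons (skewForm_neg ζ b) fun i => by
      rw [hw']
      exact h.skewForm_integralVec_sub hm i.isLt
  have e2 : pfaffianFirst (skewForm ζ b) (Fin.cons (powVec ζ (-1)) w : Fin (2 * m + 1) → _)
      (rVec ζ L γ (2 * m)) = 0 := by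
    rw [rVec_eq_sum]
    refine pfaffianFirst_sum_eq_zero _ fun i hi => ?_
    exact ⟨Fin.succ ⟨i, Finset.mem_range.1 hi⟩, by rw [Fin.cons_succ, hw']⟩
  have e3 : (Fin.cons (powVec ζ (-1)) w : Fin (2 * m + 1) → _) =
      fun i : Fin (2 * m + 1) => powVec ζ (-1 + (i : ℕ)) := by
    ext1 i
    refine Fin.cases ?_ (fun i => ?_) i <;> simp [hw]
  rw [h.skewForm_integralVec_sub_inv hm, map_sub, e2, sub_zero, pfaffianFirst_apply, e3] at e1
  rw [tau_odd hb, tau_even hb, ← hw, e1]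

theorem tau_step (h : EigenData ζ b L γ G₁ G₂ G₃) (hb : ∀ j, 0 < b j) {n : ℕ} (hn : n < N) :
    tau (spectralMeasure ζ b) (n : ℤ) 0 =
      tauRatio L γ n * tau (spectralMeasure ζ b) ((n + 1 : ℕ) : ℤ) 0 := by
  rcases Nat.even_or_odd' n with ⟨m, rfl | rfl⟩
  · exact h.tau_odd_step hb hn
  · exact h.tau_even_step hb hn

theorem tau_shift (h : EigenData ζ b L γ G₁ G₂ G₃) (hb : ∀ j, 0 < b j) {n : ℕ} (hn : n < N) :
    tau (spectralMeasure ζ b) (n : ℤ) 1 = (rPoly L γ (n + 1)).coeff 0 / 2 *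
      tau (spectralMeasure ζ b) ((n + 1 : ℕ) : ℤ) 0 := by
  rcases Nat.even_or_odd' n with ⟨m, rfl | rfl⟩
  · exact h.tau_odd_shift hb hn
  · exact h.tau_even_shift hb hn

theorem tau_inv (h : EigenData ζ b L γ G₁ G₂ G₃) (hb : ∀ j, 0 < b j) {k : ℕ} (hk : k ≤ N) :
    tau (spectralMeasure ζ b) ((k + 1 : ℕ) : ℤ) (-1) = mean b (ζ⁻¹ * G₂ k) *
      tau (spectralMeasure ζ b) (k : ℤ) 0 := by
  rcases Nat.even_or_odd' k with ⟨m, rfl | rfl⟩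
  · exact h.tau_even_inv hb hk
  · exact h.tau_odd_inv hb hk

theorem tau_zero_zero (hb : ∀ j, 0 < b j) : tau (spectralMeasure ζ b) 0 0 = 1 := by
  have := tau_even (ζ := ζ) hb 0 0
  rw [pfaffianAlternating_apply (skewForm_neg ζ b)] at this
  refine this.trans ?_
  rw [pfaffian, Finset.sum_eq_single 1]
  · simp
  · intro σ _ hσ
    exact absurd (Equiv.ext fun i => absurd i.isLt (by simp)) hσ
  · intro hne
    refine absurd ?_ hne
    simp [IsPairing]

end EigenData

namespace EigenData

variable {N : ℕ} {ζ b : Fin N → ℝ} {L γ : ℕ → ℝ} {G₁ G₂ G₃ : ℕ → Fin N → ℝ}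

/-! ### Recovery of the string -/

theorem tau_pos (h : EigenData ζ b L γ G₁ G₂ G₃) (hb : ∀ j, 0 < b j) {k : ℕ} (hk : k ≤ N) :
    0 < tau (spectralMeasure ζ b) (k : ℤ) 0 := by
  induction k with
  | zero => rw [Nat.cast_zero, tau_zero_zero hb]; exact one_pos
  | succ k ih =>
    have h1 := ih (by omega)
    rw [h.tau_step hb (by omega)] at h1
    exact pos_of_mul_pos_right h1 (h.tauRatio_pos (by omega)).le

/-- The bimoment determinant with the mass `1/2` at the origin taken into account. -/
def correctedDet (μ : Measure ℝ) (k : ℕ) : ℝ :=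
  bimomentDet μ k 0 0 + 1 / 2 * bimomentDet μ ((k : ℤ) - 1) 1 1

theorem correctedDet_zero (h : EigenData ζ b L γ G₁ G₂ G₃) (hb : ∀ j, 0 < b j) :
    correctedDet (spectralMeasure ζ b) 0 = 1 := by
  rw [correctedDet, h.det_eq_prod hb (by omega), Finset.prod_range_zero]

theorem correctedDet_succ (h : EigenData ζ b L γ G₁ G₂ G₃) (hb : ∀ j, 0 < b j) {k : ℕ}
    (hk : k ≤ N) : correctedDet (spectralMeasure ζ b) (k + 1) =
      correctedDet (spectralMeasure ζ b) k * (1 / (L k * leadAbs L γ k ^ 2)) := by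
  rw [correctedDet, correctedDet, h.det_eq_prod hb (by omega), h.det_eq_prod hb (by omega),
    Finset.prod_range_succ]

theorem correctedDet_pos (h : EigenData ζ b L γ G₁ G₂ G₃) (hb : ∀ j, 0 < b j) {k : ℕ}
    (hk : k ≤ N + 1) : 0 < correctedDet (spectralMeasure ζ b) k := by
  rw [correctedDet, h.det_eq_prod hb hk]
  refine Finset.prod_pos fun m hm => ?_
  have hm := Finset.mem_range.1 hm
  have h1 := h.L_pos m (by omega)
  have h2 := h.leadAbs_pos (show m ≤ N by omega)
  positivity

theorem leadAbs_succ (n : ℕ) : leadAbs L γ (n + 1) = leadAbs L γ n * (L n * γ n ^ 2 / 2) :=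
  Finset.prod_range_succ _ _

theorem tau_sq (h : EigenData ζ b L γ G₁ G₂ G₃) (hb : ∀ j, 0 < b j) {k : ℕ} (hk : k ≤ N) :
    tau (spectralMeasure ζ b) (k : ℤ) 0 ^ 2 * leadAbs L γ k =
      2 ^ k * correctedDet (spectralMeasure ζ b) k := by
  induction k with
  | zero => simp [tau_zero_zero hb, h.correctedDet_zero hb, leadAbs]
  | succ k ih =>
    have h1 := ih (by omega)
    have h2 := (h.L_pos k (by omega)).ne'
    have h3 := (h.leadAbs_pos (show k ≤ N by omega)).ne'
    rw [h.correctedDet_succ hb (by omega), pow_succ (2 : ℝ), leadAbs_succ]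
    have e : (2 : ℝ) ^ k * 2 * (correctedDet (spectralMeasure ζ b) k *
        (1 / (L k * leadAbs L γ k ^ 2))) =
        2 ^ k * correctedDet (spectralMeasure ζ b) k * (2 / (L k * leadAbs L γ k ^ 2)) := by ring
    rw [e, ← h1, h.tau_step hb (show k < N by omega), tauRatio]
    field_simp

theorem mass_eq (h : EigenData ζ b L γ G₁ G₂ G₃) (hb : ∀ j, 0 < b j) {n : ℕ} (hn : n < N) :
    γ n = 2 ^ (n + 1) * correctedDet (spectralMeasure ζ b) (n + 1) /
      (tau (spectralMeasure ζ b) ((n + 1 : ℕ) : ℤ) 0 * tau (spectralMeasure ζ b) (n : ℤ) 0) := by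
  have h1 := (h.tau_pos hb (show n + 1 ≤ N by omega)).ne'
  have h2 := (h.L_pos n (by omega)).ne'
  have h3 := (h.leadAbs_pos (show n ≤ N by omega)).ne'
  have h4 := (h.γ_pos n hn).ne'
  rw [← h.tau_sq hb (by omega), h.tau_step hb hn, leadAbs_succ, tauRatio]
  field_simp

theorem mass_eq_tau (h : EigenData ζ b L γ G₁ G₂ G₃) (hb : ∀ j, 0 < b j) {n : ℕ} (hn : n < N) :
    γ n = tau (spectralMeasure ζ b) (n : ℤ) 1 / tau (spectralMeasure ζ b) ((n + 1 : ℕ) : ℤ) 0 -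
      tau (spectralMeasure ζ b) ((n + 2 : ℕ) : ℤ) (-1) /
        tau (spectralMeasure ζ b) ((n + 1 : ℕ) : ℤ) 0 -
      tau (spectralMeasure ζ b) ((n : ℤ) - 1) 1 / tau (spectralMeasure ζ b) (n : ℤ) 0 +
      tau (spectralMeasure ζ b) ((n + 1 : ℕ) : ℤ) (-1) / tau (spectralMeasure ζ b) (n : ℤ) 0 := by
  have h1 := (h.tau_pos hb (show n + 1 ≤ N by omega)).ne'
  have h2 := (h.tau_pos hb hn.le).ne'
  have e1 : tau (spectralMeasure ζ b) ((n : ℤ) - 1) 1 =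
      (rPoly L γ n).coeff 0 / 2 * tau (spectralMeasure ζ b) (n : ℤ) 0 := by
    rcases n with _ | n
    · rw [rPoly_zero, tau, if_pos (by simp)]; simp
    · rw [← h.tau_shift hb (by omega)]; congr 1; push_cast; ring
  rw [h.tau_shift hb hn, h.tau_inv hb (show n + 1 ≤ N by omega), h.tau_inv hb hn.le, e1,
    mul_div_cancel_right₀ _ h1, mul_div_cancel_right₀ _ h1, mul_div_cancel_right₀ _ h2,
    mul_div_cancel_right₀ _ h2, rPoly_coeff_zero, rPoly_coeff_zero, Finset.sum_range_succ]
  linear_combination -h.mean_inv_mul_G₂_sub hn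

theorem gap_eq (h : EigenData ζ b L γ G₁ G₂ G₃) (hb : ∀ j, 0 < b j) {k : ℕ} (hk : k ≤ N) :
    L k = tau (spectralMeasure ζ b) (k : ℤ) 0 ^ 4 /
      (2 ^ (2 * k) * correctedDet (spectralMeasure ζ b) (k + 1) *
        correctedDet (spectralMeasure ζ b) k) := by
  have h1 := (h.correctedDet_pos hb (show k ≤ N + 1 by omega)).ne'
  have h2 := (h.L_pos k hk).ne'
  have h3 := (h.leadAbs_pos hk).ne'
  have e := h.tau_sq hb hk
  have e1 : tau (spectralMeasure ζ b) (k : ℤ) 0 ^ 2 =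
      2 ^ k * correctedDet (spectralMeasure ζ b) k / leadAbs L γ k := by
    rw [← e]; field_simp
  rw [show tau (spectralMeasure ζ b) (k : ℤ) 0 ^ 4 =
    (tau (spectralMeasure ζ b) (k : ℤ) 0 ^ 2) ^ 2 by ring, e1, h.correctedDet_succ hb hk]
  field_simp
  ring

theorem one_sub_sum_gap (h : EigenData ζ b L γ G₁ G₂ G₃) (hb : ∀ j, 0 < b j) {k : ℕ}
    (hk : k ≤ N + 1) : 1 - ∑ m ∈ Finset.range k, L m =
      (bimomentDet (spectralMeasure ζ b) k 0 0 -
        1 / 2 * bimomentDet (spectralMeasure ζ b) ((k : ℤ) - 1) 1 1) /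
        correctedDet (spectralMeasure ζ b) k := by
  rw [eq_div_iff (h.correctedDet_pos hb hk).ne', h.det_sub_eq hb hk, correctedDet]

end EigenData

end DualCubic

namespace DualCubicString

variable {N : ℕ} (s : DualCubicString N)

theorem pos_eq_one_sub {k : ℕ} (hk : k ≤ N + 1) :
    s.pos (N + 1 - k) = 1 - ∑ m ∈ Finset.range k, s.gap (N - m) := by
  induction k with
  | zero => simp [pos_last]
  | succ k ih =>
    have h1 := ih (by omega)
    rw [Finset.sum_range_succ, ← sub_sub, ← h1, gap, show N - k + 1 = N + 1 - k by omega,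
      show N + 1 - (k + 1) = N - k by omega]
    ring

end DualCubicString

namespace DualCubic

theorem recovery_formulas {N : ℕ} {ζ b : Fin N → ℝ} (hζ : StrictMono ζ) (hζ_pos : ∀ j, 0 < ζ j)
    (hb : ∀ j, 0 < b j) {s : DualCubicString N} (hs : s.HasSpectralData ζ b)
    {μ : Measure ℝ} (hμ : μ = spectralMeasure ζ b) :
    (∀ k : ℕ, 1 ≤ k → k ≤ N →
      s.mass (N - k + 1) =
          tau μ (k - 1) 1 / tau μ k 0 - tau μ (k + 1) (-1) / tau μ k 0
            - tau μ (k - 2) 1 / tau μ (k - 1) 0 + tau μ k (-1) / tau μ (k - 1) 0 ∧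
      s.mass (N - k + 1) =
          2 ^ k * (bimomentDet μ k 0 0 + 1 / 2 * bimomentDet μ (k - 1) 1 1)
            / (tau μ k 0 * tau μ (k - 1) 0)) ∧
    (∀ k : ℕ, k ≤ N →
      s.gap (N - k) =
          tau μ k 0 ^ 4 /
            (2 ^ (2 * k) * (bimomentDet μ (k + 1) 0 0 + 1 / 2 * bimomentDet μ k 1 1)
              * (bimomentDet μ k 0 0 + 1 / 2 * bimomentDet μ (k - 1) 1 1))) ∧
    (∀ k : ℕ, 1 ≤ k → k ≤ N →
      s.pos (N - k + 1) =
          (bimomentDet μ k 0 0 - 1 / 2 * bimomentDet μ (k - 1) 1 1)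
            / (bimomentDet μ k 0 0 + 1 / 2 * bimomentDet μ (k - 1) 1 1)) := by
  have h := eigenData_of_hasSpectralData hs hζ hζ_pos
  subst hμ
  refine ⟨fun k hk1 hk => ?_, fun k hk => ?_, fun k hk1 hk => ?_⟩
  · obtain ⟨n, rfl⟩ : ∃ n, k = n + 1 := ⟨k - 1, by omega⟩
    rw [show N - (n + 1) + 1 = N - n by omega,
      show ((n + 1 : ℕ) : ℤ) - 1 = (n : ℤ) by push_cast; ring,
      show ((n + 1 : ℕ) : ℤ) + 1 = ((n + 2 : ℕ) : ℤ) by push_cast; ring,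
      show ((n + 1 : ℕ) : ℤ) - 2 = (n : ℤ) - 1 by push_cast; ring]
    refine ⟨h.mass_eq_tau hb (by omega), ?_⟩
    have e := h.mass_eq hb (show n < N by omega)
    rwa [EigenData.correctedDet, show ((n + 1 : ℕ) : ℤ) - 1 = (n : ℤ) by push_cast; ring] at e
  · have e := h.gap_eq hb hk
    rwa [EigenData.correctedDet, EigenData.correctedDet,
      show ((k + 1 : ℕ) : ℤ) - 1 = (k : ℤ) by push_cast; ring, Nat.cast_succ] at e
  · rw [show N - k + 1 = N + 1 - k by omega, s.pos_eq_one_sub (by omega)]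
    exact h.one_sub_sum_gap hb (by omega)

end DualCubic

end

theorem mainTheorem8 {N : ℕ} (ζ b : Fin N → ℝ) (hζ : StrictMono ζ) (hζ_pos : ∀ j, 0 < ζ j)
    (hb : ∀ j, 0 < b j) (s : DualCubicString N) (hs : s.HasSpectralData ζ b)
    (μ : Measure ℝ) (hμ : μ = spectralMeasure ζ b) :
    (∀ k : ℕ, 1 ≤ k → k ≤ N →
      s.mass (N - k + 1) =
          tau μ (k - 1) 1 / tau μ k 0 - tau μ (k + 1) (-1) / tau μ k 0
            - tau μ (k - 2) 1 / tau μ (k - 1) 0 + tau μ k (-1) / tau μ (k - 1) 0 ∧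
      s.mass (N - k + 1) =
          2 ^ k * (bimomentDet μ k 0 0 + 1 / 2 * bimomentDet μ (k - 1) 1 1)
            / (tau μ k 0 * tau μ (k - 1) 0)) ∧
    (∀ k : ℕ, k ≤ N →
      s.gap (N - k) =
          tau μ k 0 ^ 4 /
            (2 ^ (2 * k) * (bimomentDet μ (k + 1) 0 0 + 1 / 2 * bimomentDet μ k 1 1)
              * (bimomentDet μ k 0 0 + 1 / 2 * bimomentDet μ (k - 1) 1 1))) ∧
    (∀ k : ℕ, 1 ≤ k → k ≤ N →
      s.pos (N - k + 1) =
          (bimomentDet μ k 0 0 - 1 / 2 * bimomentDet μ (k - 1) 1 1)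
            / (bimomentDet μ k 0 0 + 1 / 2 * bimomentDet μ (k - 1) 1 1)) ∧
    (∀ t : DualCubicString N, t.HasSpectralData ζ b → t = s) := by
  obtain ⟨h1, h2, h3⟩ := recovery_formulas hζ hζ_pos hb hs hμ
  refine ⟨h1, h2, h3, fun t ht => ?_⟩
  obtain ⟨t1, -, t3⟩ := recovery_formulas hζ hζ_pos hb ht hμ
  have hidx : ∀ i : Fin N, N - (N - (i : ℕ)) + 1 = i + 1 := fun i => by omega
  refine DualCubicString.ext (funext fun i => ?_) (funext fun i => ?_)
  · have e := (t3 (N - i) (by omega) (by omega)).trans (h3 (N - i) (by omega) (by omega)).symm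
    rwa [hidx, DualCubicString.pos_succ, DualCubicString.pos_succ] at e
  · have e := (t1 (N - i) (by omega) (by omega)).2.trans
      (h1 (N - i) (by omega) (by omega)).2.symm
    rwa [hidx, DualCubicString.mass_succ, DualCubicString.mass_succ] at e
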